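/- **Setting.** Let $j\ge 1$ be an integer, $s\in\mathbb R$ with $s\ge \frac{2-j}{2}$, and $0<\epsilon<\frac{1}{10000(2j+1)}$. Let $\eta\in C^\infty(\mathbb R;\mathbb R)$ be supported in $[-1,2]$ and equal to $1$ on $[0,1]$. Write $\mathbf T=\mathbb R/2\pi\mathbb Z$, $\dot{\mathbb Z}=\mathbb Z\setminus\{0\}$, $\langle a\rangle=(1+a^2)^{1/2}$ and $\sigma=\tau+k^{2j+1}$. Functions $u:\mathbb R\to\mathcal D'(\mathbf T)$, $t\mapsto u(t)$, are considered (so that $s<0$ is allowed). $\mathscr F_xu(k,t)$ denotes the $k$-th Fourier coefficient $\frac1{2\pi}\langle u(t),e^{-ikx}\rangle$ of $u(t)$. The function $u$ has zero $x$-mean if $\mathscr F_xu(0,t)=0$. Its space-time Fourier transform $\mathscr Fu(k,\tau)$ is normalized so that $\mathscr F_xu(k,t)=\int_{\mathbb R} e^{it\tau}\mathscr Fu(k,\tau)\,d\tau$. With sums over $k\in\dot{\mathbb Z}$, put $$\|u\|_{Y_s}=\big\|\langle k\rangle^s\langle\sigma\rangle^{1/2}\mathscr Fu\big\|_{L^2(k)L^2(\tau)}+\big\|\langle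 k\rangle^s\mathscr Fu\big\|_{L^2(k)L^1(\tau)},$$ $$\|w\|_{Z_s}=\big\|\langle k\rangle^s\langle\sigma\rangle^{-1/2}\mathscr Fw\big\|_{L^2(k)L^2(\tau)}+\big\|\langle k\rangle^s\langle\sigma\rangle^{-1}\mathscr Fw\big\|_{L^2(k)L^1(\tau)}.$$ A $u\in Y_s$ is identified with its representative for which the inversion formula holds at every $t$. For $u$ given on $[0,\delta]$, $\|u\|_{Y_s^\delta}$ is the infimum of $\|v\|_{Y_s}$ over the extensions $v$ of $u$, that is, over the zero-mean $v$ on $\mathbb R$ with $v(t)=u(t)$ for $t\in[0,\delta]$. Put $$B_\delta(v_1,v_2)=\partial_x(1-\partial_x^2)^{-1}\Big[\partial_x\big(\eta(t/\delta)v_1\big)\,\partial_x\big(\eta(t/\delta)v_2\big)\Big],$$ where the product is defined by convolution of the space-time Fourier transforms (the mode $k=0$ of the product is irrelevant, since the outer $\partial_x$ annihilates it). **Lemma 3.7.** There is a constant $C>0$, depending only on $j,s,\epsilon,\eta$, such that for every $\delta\in(0,1)$: 1. for all zero-mean $v_1,v_2$ with $\|v_1\|_{Y_s},\|v_2\|_{Y_s}<\infty$,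 the convolution that defines the product converges absolutely for every $k\ne0$ and almost every $\tau$, and $$\|B_\delta(v_1,v_2)\|_{Z_s}\le C\,\delta^{\frac{j}{2j+1}-2\epsilon}\,\|v_1\|_{Y_s}\|v_2\|_{Y_s};$$ 2. for all $u_1,u_2$ on $[0,\delta]$ with zero $x$-mean and $\|u_1\|_{Y_s^\delta},\|u_2\|_{Y_s^\delta}<\infty$ there are extensions $v_1,v_2\in Y_s$ of $u_1,u_2$ for which the same convolution converges absolutely and $$\|B_\delta(v_1,v_2)\|_{Z_s}\le C\,\delta^{\frac{j}{2j+1}-2\epsilon}\,\|u_1\|_{Y_s^\delta}\|u_2\|_{Y_s^\delta}.$$ -/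

import Mathlib

open MeasureTheory

noncomputable section

namespace Shallow

/-- The Japanese bracket `⟨x⟩ = (1 + x²)^{1/2}`. -/
def bracket (x : ℝ) : ℝ := Real.sqrt (1 + x ^ 2)

/-- Test functions on the circle `ℝ / 2πℤ`: smooth `2π`-periodic functions `ℝ → ℂ`. -/
def PeriodicTest : Submodule ℂ (ℝ → ℂ) where
  carrier := {φ | ContDiff ℝ ((⊤ : ℕ∞) : WithTop ℕ∞) φ ∧ Function.Periodic φ (2 * Real.pi)}
  add_mem' := fun ha hb => ⟨ha.1.add hb.1, ha.2.add hb.2⟩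
  zero_mem' := ⟨contDiff_const, fun _ => rfl⟩
  smul_mem' := fun c _ ha => ⟨contDiff_const.smul ha.1, fun x => by
    simp only [Pi.smul_apply, ha.2 x]⟩

/-- Periodic distributions: linear functionals on the smooth `2π`-periodic functions that are
continuous, i.e. bounded by finitely many of the seminorms `sup |φ^{(m)}|`. -/
def PeriodicDistribution : Submodule ℂ (PeriodicTest →ₗ[ℂ] ℂ) where
  carrier := {T | ∃ (N : ℕ) (C : ℝ), ∀ (φ : PeriodicTest) (M : ℝ),
    (∀ m ≤ N, ∀ x : ℝ, ‖iteratedDeriv m (φ : ℝ → ℂ) x‖ ≤ M) → ‖T φ‖ ≤ C * M}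
  add_mem' := by
    rintro S T ⟨N, C, hS⟩ ⟨N', C', hT⟩
    refine ⟨max N N', C + C', fun φ M h => ?_⟩
    have h1 := hS φ M fun m hm => h m (hm.trans (le_max_left _ _))
    have h2 := hT φ M fun m hm => h m (hm.trans (le_max_right _ _))
    calc ‖(S + T) φ‖ ≤ ‖S φ‖ + ‖T φ‖ := norm_add_le _ _
      _ ≤ (C + C') * M := by linarith
  zero_mem' := ⟨0, 0, fun φ M _ => by simp⟩
  smul_mem' := by
    rintro c T ⟨N, C, hT⟩
    refine ⟨N, ‖c‖ * C, fun φ M h => ?_⟩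
    have h1 := mul_le_mul_of_nonneg_left (hT φ M h) (norm_nonneg c)
    calc ‖(c • T) φ‖ = ‖c‖ * ‖T φ‖ := norm_mul c (T φ)
      _ ≤ ‖c‖ * C * M := by linarith

/-- The exponential `x ↦ e^{ikx}` as a test function. -/
def expTest (k : ℤ) : PeriodicTest :=
  ⟨fun x : ℝ => Complex.exp (Complex.I * k * x), by
    refine ⟨?_, fun x => ?_⟩
    · exact (contDiff_const.mul Complex.ofRealCLM.contDiff).cexp
    · have : Complex.I * k * ((x + 2 * Real.pi : ℝ) : ℂ)
          = Complex.I * k * x + k * (2 * Real.pi * Complex.I) := by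
        push_cast; ring
      simp only [this]
      rw [Complex.exp_add, Complex.exp_int_mul_two_pi_mul_I, mul_one]⟩

/-- Fourier coefficient `(2π)⁻¹ ⟨T, e^{-ikx}⟩`; for a function `f` it is
`(2π)⁻¹ ∫₀^{2π} e^{-ikx} f(x) dx`. -/
def coeff (T : PeriodicDistribution) (k : ℤ) : ℂ :=
  (2 * Real.pi : ℂ)⁻¹ * (T : PeriodicTest →ₗ[ℂ] ℂ) (expTest (-k))

/-- `‖⟨k⟩^s ⟨τ + k^{2j+1}⟩^b F(k,τ)‖` in `L²(k) L²(τ)`, the sum being over the nonzero integers. -/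
def weightedL2L2 (j : ℕ) (s b : ℝ) (F : ℤ → ℝ → ℂ) : ENNReal :=
  (∑' k : {k : ℤ // k ≠ 0}, ∫⁻ τ : ℝ,
    (ENNReal.ofReal (bracket (k.1 : ℝ) ^ s * bracket (τ + (k.1 : ℝ) ^ (2 * j + 1)) ^ b)
      * ‖F k.1 τ‖ₑ) ^ 2) ^ (1 / 2 : ℝ)

/-- `‖⟨k⟩^s ⟨τ + k^{2j+1}⟩^b F(k,τ)‖` in `L²(k) L¹(τ)`, the sum being over the nonzero integers. -/
def weightedL2L1 (j : ℕ) (s b : ℝ) (F : ℤ → ℝ → ℂ) : ENNReal :=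
  (∑' k : {k : ℤ // k ≠ 0}, (∫⁻ τ : ℝ,
    ENNReal.ofReal (bracket (k.1 : ℝ) ^ s * bracket (τ + (k.1 : ℝ) ^ (2 * j + 1)) ^ b)
      * ‖F k.1 τ‖ₑ) ^ 2) ^ (1 / 2 : ℝ)

/-- The `Y_s` norm in terms of the space-time Fourier transform. -/
def normYHat (j : ℕ) (s : ℝ) (F : ℤ → ℝ → ℂ) : ENNReal :=
  weightedL2L2 j s (1 / 2) F + weightedL2L1 j s 0 F

/-- The `Z_s` norm in terms of the space-time Fourier transform. -/
def normZHat (j : ℕ) (s : ℝ) (F : ℤ → ℝ → ℂ) : ENNReal :=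
  weightedL2L2 j s (-1 / 2) F + weightedL2L1 j s (-1) F

/-- `F` is the space-time Fourier transform of `u` off the zero spatial mode, in the sense of the
inversion formula: `u(t)^(k) = ∫ e^{itτ} F(k,τ) dτ`.  Every element of `Y_s` has a transform that
is integrable in `τ`, so it is of this form (in its representative continuous in `t`). -/
def HasSTFourier (u : ℝ → PeriodicDistribution) (F : ℤ → ℝ → ℂ) : Prop :=
  ∀ k : ℤ, k ≠ 0 → Integrable (F k) ∧
    ∀ t : ℝ, coeff (u t) k = ∫ τ : ℝ, Complex.exp (Complex.I * t * τ) * F k τ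

/-- The `Y_s` norm of `u`; it is `∞` when `u` is not in `Y_s`.  The transform `F` is unique almost
everywhere, so the infimum is over representatives of one object. -/
def normY (j : ℕ) (s : ℝ) (u : ℝ → PeriodicDistribution) : ENNReal :=
  ⨅ (F : ℤ → ℝ → ℂ) (_ : HasSTFourier u F), normYHat j s F

/-- `u` has zero `x`-mean for all times in `I`. -/
def ZeroMeanOn (I : Set ℝ) (u : ℝ → PeriodicDistribution) : Prop :=
  ∀ t ∈ I, coeff (u t) 0 = 0

/-- `v` is a zero-mean extension to all times of the restriction of `u` to `[0,δ]`. -/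
def IsExtension (δ : ℝ) (u v : ℝ → PeriodicDistribution) : Prop :=
  ZeroMeanOn Set.univ v ∧ ∀ t ∈ Set.Icc 0 δ, v t = u t

/-- The `Y_s^δ` norm of the restriction of `u` to `[0,δ]`. -/
def normYδ (j : ℕ) (s δ : ℝ) (u : ℝ → PeriodicDistribution) : ENNReal :=
  ⨅ (v : ℝ → PeriodicDistribution) (_ : IsExtension δ u v), normY j s v

/-- The localization `η(t/δ) u`. -/
def cutoff (η : ℝ → ℝ) (δ : ℝ) (u : ℝ → PeriodicDistribution) : ℝ → PeriodicDistribution :=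
  fun t => ((η (t / δ) : ℝ) : ℂ) • u t

/-- Space-time Fourier transform of a `w` that is integrable in time:
`(2π)⁻¹ ∫ e^{-itτ} w(t)^(k) dt`. -/
def stFourier (w : ℝ → PeriodicDistribution) (k : ℤ) (τ : ℝ) : ℂ :=
  (2 * Real.pi : ℂ)⁻¹ * ∫ t : ℝ, Complex.exp (-(Complex.I * t * τ)) * coeff (w t) k

/-- `∂_x` on the Fourier side. -/
def dxHat (F : ℤ → ℝ → ℂ) (k : ℤ) (τ : ℝ) : ℂ := Complex.I * k * F k τ

/-- `(1 - ∂_x²)⁻¹` on the Fourier side. -/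
def resolventHat (F : ℤ → ℝ → ℂ) (k : ℤ) (τ : ℝ) : ℂ := (1 + (k : ℂ) ^ 2)⁻¹ * F k τ

/-- The convolution integrand, at `(k₁,τ₁) = p`, of the product of two distributions. -/
def convIntegrand (F G : ℤ → ℝ → ℂ) (k : ℤ) (τ : ℝ) (p : ℤ × ℝ) : ℂ :=
  F p.1 p.2 * G (k - p.1) (τ - p.2)

/-- The Fourier transform of a product: convolution on `ℤ × ℝ`. -/
def mulHat (F G : ℤ → ℝ → ℂ) (k : ℤ) (τ : ℝ) : ℂ :=
  ∫ p : ℤ × ℝ, convIntegrand F G k τ p ∂(Measure.count.prod volume)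

/-- The product `∂_x(η(t/δ) u₁) · ∂_x(η(t/δ) u₂)` is well defined off the zero spatial mode
(which `∂_x` annihilates): its convolution integral converges absolutely for almost every `τ`. -/
def ProductDefined (η : ℝ → ℝ) (δ : ℝ) (u₁ u₂ : ℝ → PeriodicDistribution) : Prop :=
  ∀ k : ℤ, k ≠ 0 → ∀ᵐ τ : ℝ, Integrable
    (convIntegrand (dxHat (stFourier (cutoff η δ u₁))) (dxHat (stFourier (cutoff η δ u₂))) k τ)
    (Measure.count.prod volume)

/-- The space-time Fourier transform of
`∂_x (1 - ∂_x²)⁻¹ [∂_x(η(t/δ) u₁) · ∂_x(η(t/δ) u₂)]`. -/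
def bilinearHat (η : ℝ → ℝ) (δ : ℝ) (u₁ u₂ : ℝ → PeriodicDistribution) : ℤ → ℝ → ℂ :=
  dxHat (resolventHat
    (mulHat (dxHat (stFourier (cutoff η δ u₁))) (dxHat (stFourier (cutoff η δ u₂)))))

end Shallow

end

namespace Shallow

/-! The estimate combines a resonance bound with a gain from localizing in time. On the Fourier
side, multiplication by `η(t/δ)` is convolution in `τ` with a kernel dominated by `δ / (1 + (δτ)²)`.
Its `L¹` norm is bounded, its `L²` norm is of size `δ^{1/2}`, and its `L²` norm with weight
`|τ|^{1/2}` is bounded. So a localized mode keeps its `L¹` and weighted `L²` bounds, and its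
unweighted `L²` norm gains `δ^{1/2}` (`modeBound_smear`).

For `k = k₁ + k₂`, all nonzero, put `D = |k^{2j+1} - k₁^{2j+1} - k₂^{2j+1}|`. The three modulations
differ by `D`, so one of them is at least `D/3` (`conv_le_resonance`), which supplies a factor
`D^{-1/2}`. If it is the output modulation, the factor comes from the weight of `Z_s`. Otherwise it
is taken from the `⟨σ⟩^{1/2}` of an input. In both cases the `δ^{1/2}` gain survives up to a loss
`δ^{-γ}`, with `γ > 0` arbitrary, which pays for the logarithmic divergence of `∫ ⟨σ⟩⁻¹` over `⟨σ⟩ <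
δ⁻¹` (`modeZ_of_l2_of_sup`, `modeZ_conv`).

Since `D ≥ |k₁k₂|^j |k|` (`resonance`) and `s - 1 ≥ -j/2`, the weighted symbol is at most a constant
times `|k|⁻¹ ⟨k₁⟩^s ⟨k₂⟩^s D^{1/2}` (`symbol_le`). The power of `D` cancels, Cauchy–Schwarz sums
over `k₁`, and `|k|⁻¹ ∈ ℓ²` sums over `k` (`exists_normZHat_le`). The choice `1/2 - γ = j/(2j+1)`
gives the stated power of `δ` with room to spare. For functions on `[0,δ]`, nearly optimal
extensions are used (`exists_extension_normY_le`). -/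

/-- The `L²` norm of an extended nonnegative function. -/
noncomputable def l2 {α : Type*} [MeasurableSpace α] (μ : Measure α) (f : α → ENNReal) : ENNReal :=
  (∫⁻ x, f x ^ 2 ∂μ) ^ (1 / 2 : ℝ)

/-! ### `L²` and convolution inequalities for extended nonnegative functions. -/

section L2

variable {α : Type*} [MeasurableSpace α] {μ : Measure α}

theorem sq_sqrt_ennreal (a : ENNReal) : (a ^ (1 / 2 : ℝ)) ^ 2 = a := by
  rw [← ENNReal.rpow_natCast, ← ENNReal.rpow_mul]; norm_num

theorem sqrt_sq_ennreal (a : ENNReal) : (a ^ 2) ^ (1 / 2 : ℝ) = a := by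
  rw [← ENNReal.rpow_natCast, ← ENNReal.rpow_mul]; norm_num

theorem l2_sq (f : α → ENNReal) : l2 μ f ^ 2 = ∫⁻ x, f x ^ 2 ∂μ := sq_sqrt_ennreal _

theorem l2_le_iff {f : α → ENNReal} {a : ENNReal} : l2 μ f ≤ a ↔ ∫⁻ x, f x ^ 2 ∂μ ≤ a ^ 2 := by
  rw [← l2_sq]
  exact (ENNReal.pow_le_pow_left_iff two_ne_zero).symm

theorem l2_mono {f g : α → ENNReal} (h : ∀ x, f x ≤ g x) : l2 μ f ≤ l2 μ g :=
  ENNReal.rpow_le_rpow (lintegral_mono fun x => pow_le_pow_left' (h x) 2) (by norm_num)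

theorem lintegral_mul_le_l2 {f g : α → ENNReal} (hf : AEMeasurable f μ) (hg : AEMeasurable g μ) :
    ∫⁻ x, f x * g x ∂μ ≤ l2 μ f * l2 μ g := by
  have h := ENNReal.lintegral_mul_le_Lp_mul_Lq μ Real.HolderConjugate.two_two hf hg
  simpa [l2] using h

theorem l2_add_le {f g : α → ENNReal} (hf : AEMeasurable f μ) (hg : AEMeasurable g μ) :
    l2 μ (fun x => f x + g x) ≤ l2 μ f + l2 μ g := by
  have h := ENNReal.lintegral_Lp_add_le (μ := μ) hf hg (p := 2) (by norm_num)
  simpa [l2] using h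

theorem l2_const_mul {c : ENNReal} {f : α → ENNReal} (hf : AEMeasurable f μ) :
    l2 μ (fun x => c * f x) = c * l2 μ f := by
  unfold l2
  simp_rw [mul_pow]
  rw [lintegral_const_mul'' _ (hf.pow_const 2), ENNReal.mul_rpow_of_nonneg _ _ (by norm_num),
    sqrt_sq_ennreal]

/-- Countable Minkowski inequality: expand the square as a double sum and apply Cauchy–Schwarz to
each term. -/
theorem l2_tsum_le {ι : Type*} [Countable ι] {g : ι → α → ENNReal}
    (hg : ∀ i, AEMeasurable (g i) μ) :
    l2 μ (fun x => ∑' i, g i x) ≤ ∑' i, l2 μ (g i) := by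
  rw [l2_le_iff]
  calc ∫⁻ x, (∑' i, g i x) ^ 2 ∂μ = ∫⁻ x, ∑' i, ∑' k, g i x * g k x ∂μ := by
        simp_rw [sq, ENNReal.tsum_mul_left, ENNReal.tsum_mul_right]
    _ = ∑' i, ∑' k, ∫⁻ x, g i x * g k x ∂μ := by
        have h : ∀ i k, AEMeasurable (fun x => g i x * g k x) μ := fun i k => (hg i).mul (hg k)
        rw [lintegral_tsum fun i => AEMeasurable.tsum fun k => h i k]
        exact tsum_congr fun i => lintegral_tsum fun k => h i k
    _ ≤ ∑' i, ∑' k, l2 μ (g i) * l2 μ (g k) :=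
        ENNReal.tsum_le_tsum fun i => ENNReal.tsum_le_tsum fun k =>
          lintegral_mul_le_l2 (hg i) (hg k)
    _ = (∑' i, l2 μ (g i)) ^ 2 := by
        simp_rw [sq, ENNReal.tsum_mul_left, ENNReal.tsum_mul_right]

theorem l2_count {ι : Type*} [MeasurableSpace ι] [MeasurableSingletonClass ι] (f : ι → ENNReal) :
    l2 Measure.count f = (∑' i, f i ^ 2) ^ (1 / 2 : ℝ) := by
  rw [l2, lintegral_count]

end L2

/-- Convolution on the line of extended nonnegative functions. -/
noncomputable def conv (f g : ℝ → ENNReal) (x : ℝ) : ENNReal := ∫⁻ y, f y * g (x - y)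

section Conv

variable {f g : ℝ → ENNReal}

theorem measurable_conv (hf : Measurable f) (hg : Measurable g) : Measurable (conv f g) :=
  Measurable.lintegral_prod_right' (f := fun p : ℝ × ℝ => f p.2 * g (p.1 - p.2)) (by fun_prop)

theorem conv_comm (f g : ℝ → ENNReal) : conv f g = conv g f := by
  funext x
  unfold conv
  rw [← lintegral_sub_left_eq_self _ x]
  simp [mul_comm]

theorem lintegral_conv (hf : Measurable f) (hg : Measurable g) :
    ∫⁻ x, conv f g x = (∫⁻ x, f x) * ∫⁻ x, g x := by
  unfold conv
  rw [lintegral_lintegral_swap (by fun_prop)]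
  have : ∀ y, ∫⁻ x, f y * g (x - y) = f y * ∫⁻ x, g x := fun y => by
    rw [lintegral_const_mul _ (by fun_prop), lintegral_sub_right_eq_self g y]
  simp_rw [this]
  rw [lintegral_mul_const _ hf]

theorem l2_sub_left (g : ℝ → ENNReal) (x : ℝ) : l2 volume (fun y => g (x - y)) = l2 volume g := by
  unfold l2
  rw [lintegral_sub_left_eq_self (fun y => g y ^ 2) x]

theorem conv_le_l2 (hf : Measurable f) (hg : Measurable g) (x : ℝ) :
    conv f g x ≤ l2 volume f * l2 volume g := by
  rw [← l2_sub_left g x]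
  exact lintegral_mul_le_l2 hf.aemeasurable (by fun_prop)

/-- Young's inequality `L¹ * L² ⊆ L²`. Writing `f = f^{1/2} · f^{1/2}`, Cauchy–Schwarz bounds the
square of the convolution pointwise by `‖f‖₁ (f * g²)`, which Tonelli integrates. -/
theorem l2_conv_le (hf : Measurable f) (hg : Measurable g) :
    l2 volume (conv f g) ≤ (∫⁻ x, f x) * l2 volume g := by
  have hpt : ∀ x, conv f g x ^ 2 ≤ (∫⁻ y, f y) * conv f (fun y => g y ^ 2) x := fun x => by
    have h := lintegral_mul_le_l2 (μ := volume) (f := fun y => f y ^ (1 / 2 : ℝ))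
      (g := fun y => f y ^ (1 / 2 : ℝ) * g (x - y)) (by fun_prop) (by fun_prop)
    have e : conv f g x = ∫⁻ y, f y ^ (1 / 2 : ℝ) * (f y ^ (1 / 2 : ℝ) * g (x - y)) := by
      simp_rw [← mul_assoc, ← sq, sq_sqrt_ennreal]; rfl
    rw [e]
    refine (pow_le_pow_left' h 2).trans_eq ?_
    rw [mul_pow, l2_sq, l2_sq]
    simp_rw [mul_pow, sq_sqrt_ennreal]
    rfl
  rw [l2_le_iff, mul_pow, l2_sq]
  calc ∫⁻ x, conv f g x ^ 2 ≤ ∫⁻ x, (∫⁻ y, f y) * conv f (fun y => g y ^ 2) x := lintegral_mono hpt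
    _ = _ := by
      rw [lintegral_const_mul _ (measurable_conv hf (by fun_prop)), lintegral_conv hf (by fun_prop)]
      ring

end Conv

/-! ### Japanese bracket weights and the localization kernel. -/

theorem bracket_pos (x : ℝ) : 0 < bracket x := Real.sqrt_pos.2 (by positivity)

theorem bracket_sq (x : ℝ) : bracket x ^ 2 = 1 + x ^ 2 := Real.sq_sqrt (by positivity)

theorem one_le_bracket (x : ℝ) : 1 ≤ bracket x := Real.one_le_sqrt.2 (by nlinarith [sq_nonneg x])

theorem abs_le_bracket (x : ℝ) : |x| ≤ bracket x := by
  rw [← Real.sqrt_sq_eq_abs]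
  exact Real.sqrt_le_sqrt (by linarith)

theorem bracket_add_le (x y : ℝ) : bracket (x + y) ≤ bracket x + |y| := by
  have h1 := abs_le_bracket x
  have h2 := le_abs_self (x * y)
  rw [abs_mul] at h2
  have h3 := mul_le_mul_of_nonneg_right h1 (abs_nonneg y)
  refine Real.sqrt_le_iff.2 ⟨by have := bracket_pos x; positivity, ?_⟩
  nlinarith [bracket_sq x, sq_abs y]

theorem continuous_bracket : Continuous bracket := by unfold bracket; fun_prop

/-- The weight `⟨x⟩^b`. -/
noncomputable def japW (b x : ℝ) : ENNReal := ENNReal.ofReal (bracket x ^ b)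

@[fun_prop]
theorem measurable_japW (b : ℝ) : Measurable (japW b) :=
  ENNReal.measurable_ofReal.comp
    (continuous_bracket.rpow_const fun x => Or.inl (bracket_pos x).ne').measurable

theorem japW_half_add_le (x y : ℝ) :
    japW (1 / 2) (x + y) ≤ japW (1 / 2) x + ENNReal.ofReal (|y| ^ (1 / 2 : ℝ)) := by
  have hx := bracket_pos x
  unfold japW
  rw [← ENNReal.ofReal_add (by positivity) (by positivity)]
  refine ENNReal.ofReal_le_ofReal ?_
  refine (Real.rpow_le_rpow (bracket_pos _).le (bracket_add_le x y) (by norm_num)).trans ?_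
  exact Real.rpow_add_le_add_rpow hx.le (abs_nonneg y) (by norm_num) (by norm_num)

theorem lintegral_japW_lt_top {γ : ℝ} (hγ : 0 < γ) : ∫⁻ x, japW (-1 - γ) x < ⊤ := by
  have h : Integrable (fun x : ℝ => (1 + ‖x‖ ^ 2) ^ (-(1 + γ) / 2)) :=
    integrable_rpow_neg_one_add_norm_sq (by simpa using hγ)
  refine lt_of_le_of_lt (lintegral_mono fun x => ?_) h.lintegral_lt_top
  refine ENNReal.ofReal_le_ofReal (le_of_eq ?_)
  rw [bracket, Real.sqrt_eq_rpow, ← Real.rpow_mul (by positivity), Real.norm_eq_abs, sq_abs]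
  congr 1; ring

/-- The kernel `δ / (1 + (δx)²)`. -/
noncomputable def poissonKer (δ x : ℝ) : ENNReal := ENNReal.ofReal (δ / (1 + (δ * x) ^ 2))

@[fun_prop]
theorem measurable_poissonKer (δ : ℝ) : Measurable (poissonKer δ) := by
  unfold poissonKer; fun_prop

theorem lintegral_poissonKer {δ : ℝ} (hδ : 0 < δ) :
    ∫⁻ x, poissonKer δ x = ENNReal.ofReal Real.pi := by
  have hi : Integrable fun x : ℝ => δ / (1 + (δ * x) ^ 2) := by
    simpa [div_eq_mul_inv] using
      (integrable_inv_one_add_sq.comp_mul_left' hδ.ne').const_mul δ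
  unfold poissonKer
  rw [← ofReal_integral_eq_lintegral_ofReal hi (ae_of_all _ fun x => by positivity)]
  congr 1
  simp_rw [div_eq_mul_inv]
  rw [integral_const_mul, Measure.integral_comp_mul_left (fun y : ℝ => (1 + y ^ 2)⁻¹) δ,
    integral_univ_inv_one_add_sq, abs_of_pos (by positivity)]
  simp [hδ.ne']

theorem lintegral_poissonKer_le {δ : ℝ} (hδ : 0 < δ) : ∫⁻ x, poissonKer δ x ≤ 4 := by
  rw [lintegral_poissonKer hδ]
  exact ENNReal.ofReal_le_of_le_toReal (by simpa using Real.pi_le_four)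

theorem ofReal_sqrt_sq {x : ℝ} (hx : 0 ≤ x) :
    ENNReal.ofReal (x ^ (1 / 2 : ℝ)) ^ 2 = ENNReal.ofReal x := by
  rw [← ENNReal.ofReal_pow (by positivity), ← Real.sqrt_eq_rpow, Real.sq_sqrt hx]

theorem l2_poissonKer_le {δ : ℝ} (hδ : 0 < δ) :
    l2 volume (poissonKer δ) ≤ 2 * ENNReal.ofReal (δ ^ (1 / 2 : ℝ)) := by
  rw [l2_le_iff, mul_pow, ofReal_sqrt_sq hδ.le]
  calc ∫⁻ x, poissonKer δ x ^ 2 ≤ ∫⁻ x, ENNReal.ofReal δ * poissonKer δ x := by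
        refine lintegral_mono fun x => ?_
        rw [sq]
        refine mul_le_mul_left (ENNReal.ofReal_le_ofReal ?_) _
        exact div_le_self hδ.le (by nlinarith [sq_nonneg (δ * x)])
    _ ≤ ENNReal.ofReal δ * 4 := by
        rw [lintegral_const_mul _ (by fun_prop)]
        gcongr
        exact lintegral_poissonKer_le hδ
    _ = 2 ^ 2 * ENNReal.ofReal δ := by rw [mul_comm]; norm_num

/-- The quantity is scale invariant, so no power of `δ` appears: `|x|` times the kernel is at most
`1`, which reduces the square to the kernel itself. -/
theorem l2_sqrt_mul_poissonKer_le {δ : ℝ} (hδ : 0 < δ) :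
    l2 volume (fun x => ENNReal.ofReal (|x| ^ (1 / 2 : ℝ)) * poissonKer δ x) ≤ 2 := by
  rw [l2_le_iff]
  calc ∫⁻ x, (ENNReal.ofReal (|x| ^ (1 / 2 : ℝ)) * poissonKer δ x) ^ 2
      ≤ ∫⁻ x, poissonKer δ x := by
        refine lintegral_mono fun x => ?_
        rw [mul_pow, ofReal_sqrt_sq (abs_nonneg x), sq (poissonKer δ x), ← mul_assoc]
        refine mul_le_of_le_one_left' ?_
        rw [poissonKer, ← ENNReal.ofReal_mul (abs_nonneg x), ENNReal.ofReal_le_one,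
          mul_div_assoc', div_le_one (by positivity), mul_pow]
        nlinarith [sq_abs x, sq_nonneg (|x| * δ - 1), sq_nonneg (|x| * δ)]
    _ ≤ 4 := lintegral_poissonKer_le hδ
    _ = 2 ^ 2 := by norm_num

/-! ### Localization of a single mode. -/

/-- The modulus of the Fourier side of the localization in time to scale `δ`, on one mode. -/
noncomputable def smear (δ : ℝ) (f : ℝ → ENNReal) : ℝ → ENNReal := conv (poissonKer δ) f

theorem measurable_smear {δ : ℝ} {f : ℝ → ENNReal} (hf : Measurable f) : Measurable (smear δ f) :=
  measurable_conv (by fun_prop) hf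

/-- The `Y` norm on one mode with modulation `τ + c`. -/
noncomputable def modeY (c : ℝ) (f : ℝ → ENNReal) : ENNReal :=
  l2 volume (fun x => japW (1 / 2) (x + c) * f x) + ∫⁻ x, f x

/-- The three bounds, in terms of a number `A`, that hold for a mode localized to scale `δ`. -/
structure ModeBound (δ c : ℝ) (A : ENNReal) (a : ℝ → ENNReal) : Prop where
  meas : Measurable a
  one : ∫⁻ x, a x ≤ A
  two : l2 volume a ≤ ENNReal.ofReal (δ ^ (1 / 2 : ℝ)) * A
  half : l2 volume (fun x => japW (1 / 2) (x + c) * a x) ≤ A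

/-- Young's inequality throughout. The gain in `two` puts the kernel in `L²` and `f` in `L¹`. For
`half`, subadditivity of the square root moves the weight either onto `f` (kernel in `L¹`) or onto
the kernel as `|y|^{1/2}` (kernel in `L²`, `f` in `L¹`); this is why both pieces of the `Y` norm are
needed. -/
theorem modeBound_smear {δ : ℝ} (hδ : 0 < δ) (c : ℝ) {f : ℝ → ENNReal} (hf : Measurable f) :
    ModeBound δ c (4 * modeY c f) (smear δ f) where
  meas := measurable_smear hf
  one := by
    unfold smear
    rw [lintegral_conv (by fun_prop) hf]
    exact mul_le_mul' (lintegral_poissonKer_le hδ) le_add_self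
  two := by
    unfold smear
    rw [conv_comm]
    refine (l2_conv_le hf (by fun_prop)).trans ?_
    calc (∫⁻ x, f x) * l2 volume (poissonKer δ)
        ≤ modeY c f * (2 * ENNReal.ofReal (δ ^ (1 / 2 : ℝ))) :=
          mul_le_mul' le_add_self (l2_poissonKer_le hδ)
      _ ≤ modeY c f * (4 * ENNReal.ofReal (δ ^ (1 / 2 : ℝ))) := by gcongr; norm_num
      _ = _ := by ring
  half := by
    have hpt : ∀ x, japW (1 / 2) (x + c) * smear δ f x ≤
        conv (poissonKer δ) (fun y => japW (1 / 2) (y + c) * f y) x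
          + conv (fun y => ENNReal.ofReal (|y| ^ (1 / 2 : ℝ)) * poissonKer δ y) f x := fun x => by
      unfold smear conv
      rw [← lintegral_const_mul _ (by fun_prop), ← lintegral_add_left (by fun_prop)]
      refine lintegral_mono fun y => ?_
      have h := japW_half_add_le (x - y + c) y
      rw [show x - y + c + y = x + c by ring] at h
      calc japW (1 / 2) (x + c) * (poissonKer δ y * f (x - y))
          ≤ _ := mul_le_mul_left h _
        _ = _ := by ring
    refine (l2_mono hpt).trans ((l2_add_le (measurable_conv (by fun_prop) (by fun_prop)).aemeasurable
      (measurable_conv (by fun_prop) hf).aemeasurable).trans ?_)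
    rw [conv_comm _ f]
    calc _ ≤ 4 * l2 volume (fun x => japW (1 / 2) (x + c) * f x) + (∫⁻ x, f x) * 2 :=
          add_le_add ((l2_conv_le (by fun_prop) (by fun_prop)).trans
              (mul_le_mul_left (lintegral_poissonKer_le hδ) _))
            ((l2_conv_le hf (by fun_prop)).trans
              (mul_le_mul_right (l2_sqrt_mul_poissonKer_le hδ) _))
      _ ≤ 4 * l2 volume (fun x => japW (1 / 2) (x + c) * f x) + (∫⁻ x, f x) * 4 := by
          gcongr; norm_num
      _ = 4 * modeY c f := by unfold modeY; ring

/-! ### The `Z` norm of a single output mode. -/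

theorem japW_neg_half_sq (x : ℝ) : japW (-1 / 2) x ^ 2 = japW (-1) x := by
  have := bracket_pos x
  rw [japW, ← ENNReal.ofReal_pow (by positivity), ← Real.rpow_natCast, ← Real.rpow_mul this.le, japW]
  norm_num

/-- The weight `⟨x⟩⁻¹` restricted to `⟨x⟩ ≥ M`. -/
noncomputable def tailW (M x : ℝ) : ENNReal := {x | M ≤ bracket x}.indicator (japW (-1)) x

@[fun_prop]
theorem measurable_tailW (M : ℝ) : Measurable (tailW M) :=
  (measurable_japW _).indicator (measurableSet_le measurable_const continuous_bracket.measurable)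

/-- On `⟨x⟩ ≥ M` one has `⟨x⟩⁻² ≤ 2 / (M² + x²)`, which is `2M⁻¹` times the kernel at scale `M⁻¹`.
The integral is at most `8M⁻¹`, and `8 ≤ 3²`. -/
theorem l2_tailW_le {M : ℝ} (hM : 0 < M) (c : ℝ) :
    l2 volume (fun x => tailW M (x + c)) ≤ 3 * ENNReal.ofReal (M⁻¹ ^ (1 / 2 : ℝ)) := by
  have hM' : 0 < M⁻¹ := inv_pos.2 hM
  rw [l2_le_iff, mul_pow, ofReal_sqrt_sq hM'.le,
    lintegral_add_right_eq_self (fun x => tailW M x ^ 2) c]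
  calc ∫⁻ x, tailW M x ^ 2 ≤ ∫⁻ x, ENNReal.ofReal (2 * M⁻¹) * poissonKer M⁻¹ x := by
        refine lintegral_mono fun x => ?_
        by_cases hx : M ≤ bracket x
        · have hb := bracket_pos x
          rw [tailW, Set.indicator_of_mem (by exact hx), japW, poissonKer,
            ← ENNReal.ofReal_pow (by positivity), ← ENNReal.ofReal_mul (by positivity)]
          refine ENNReal.ofReal_le_ofReal ?_
          have h2 : M ^ 2 ≤ 1 + x ^ 2 := by
            rw [← bracket_sq]; exact pow_le_pow_left₀ hM.le hx 2
          rw [Real.rpow_neg_one, inv_pow, bracket_sq]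
          have e : 2 * M⁻¹ * (M⁻¹ / (1 + (M⁻¹ * x) ^ 2)) = 2 / (M ^ 2 + x ^ 2) := by
            field_simp
          rw [e, inv_eq_one_div, div_le_div_iff₀ (by positivity) (by positivity)]
          nlinarith [sq_nonneg x]
        · rw [tailW, Set.indicator_of_notMem (by exact hx)]
          simp
    _ ≤ ENNReal.ofReal (2 * M⁻¹) * 4 := by
        rw [lintegral_const_mul _ (by fun_prop)]
        gcongr
        exact lintegral_poissonKer_le hM'
    _ ≤ 3 ^ 2 * ENNReal.ofReal M⁻¹ := by
        rw [ENNReal.ofReal_mul (by norm_num), mul_comm, ← mul_assoc]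
        gcongr
        norm_num

/-- `⟨x⟩⁻¹` just fails to be integrable. Below `⟨x⟩ = δ⁻¹` it is traded for an integrable weight at
the cost `δ^{-γ}`; above, it is square integrable with small norm. -/
theorem japW_neg_one_le {δ γ : ℝ} (hδ : 0 < δ) (hγ : 0 < γ) (x : ℝ) :
    japW (-1) x ≤ ENNReal.ofReal (δ ^ (-γ)) * japW (-1 - γ) x + tailW δ⁻¹ x := by
  by_cases hx : δ⁻¹ ≤ bracket x
  · rw [tailW, Set.indicator_of_mem (by exact hx)]
    exact le_add_self
  · refine le_add_right ?_
    have hb := bracket_pos x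
    rw [japW, japW, ← ENNReal.ofReal_mul (by positivity)]
    refine ENNReal.ofReal_le_ofReal ?_
    have h : bracket x ^ γ ≤ δ ^ (-γ) := by
      rw [Real.rpow_neg hδ.le, ← Real.inv_rpow hδ.le]
      exact Real.rpow_le_rpow hb.le (not_le.1 hx).le hγ.le
    calc bracket x ^ (-1 : ℝ) = bracket x ^ γ * bracket x ^ (-1 - γ) := by
          rw [← Real.rpow_add hb]; congr 1; ring
      _ ≤ _ := by gcongr

theorem ofReal_rpow_add {δ : ℝ} (hδ : 0 < δ) (a b : ℝ) :
    ENNReal.ofReal (δ ^ a) * ENNReal.ofReal (δ ^ b) = ENNReal.ofReal (δ ^ (a + b)) := by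
  rw [← ENNReal.ofReal_mul (by positivity), Real.rpow_add hδ]

theorem ofReal_rpow_le {δ : ℝ} (hδ : 0 < δ) (hδ1 : δ < 1) {a b : ℝ} (h : a ≤ b) :
    ENNReal.ofReal (δ ^ b) ≤ ENNReal.ofReal (δ ^ a) :=
  ENNReal.ofReal_le_ofReal (Real.rpow_le_rpow_of_exponent_ge hδ hδ1.le h)

/-- The two pieces of the `Z` norm on one mode with modulation `τ + c` are at most `A`. -/
structure ModeZ (c : ℝ) (A : ENNReal) (g : ℝ → ENNReal) : Prop where
  one : ∫⁻ x, japW (-1) (x + c) * g x ≤ A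
  two : l2 volume (fun x => japW (-1 / 2) (x + c) * g x) ≤ A

theorem ModeZ.mono {c : ℝ} {A B : ENNReal} {g h : ℝ → ENNReal} (hg : ModeZ c A g) (hAB : A ≤ B)
    (hh : ∀ x, h x ≤ g x) : ModeZ c B h where
  one := (lintegral_mono fun x => mul_le_mul_right (hh x) _).trans (hg.one.trans hAB)
  two := (l2_mono fun x => mul_le_mul_right (hh x) _).trans (hg.two.trans hAB)

theorem ModeZ.add {c : ℝ} {A B : ENNReal} {g h : ℝ → ENNReal} (hg : ModeZ c A g)
    (hh : ModeZ c B h) (mg : Measurable g) (mh : Measurable h) :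
    ModeZ c (A + B) (fun x => g x + h x) where
  one := by
    simp_rw [mul_add]
    rw [lintegral_add_left (by fun_prop)]
    exact add_le_add hg.one hh.one
  two := by
    simp_rw [mul_add]
    exact (l2_add_le (by fun_prop) (by fun_prop)).trans (add_le_add hg.two hh.two)

theorem ModeZ.const_mul {c : ℝ} {A : ENNReal} {g : ℝ → ENNReal} (hg : ModeZ c A g)
    (mg : Measurable g) (r : ENNReal) : ModeZ c (r * A) (fun x => r * g x) where
  one := by
    simp_rw [mul_left_comm _ r]
    rw [lintegral_const_mul _ (by fun_prop)]
    gcongr; exact hg.one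
  two := by
    simp_rw [mul_left_comm _ r]
    rw [l2_const_mul (by fun_prop)]
    gcongr; exact hg.two

/-- Serves the case where an input carries the large modulation: its weight is spent, so the `L²`
bound has no power of `δ`, and the gain must come from the sup bound for `⟨σ⟩ < δ⁻¹` and from the
tail of the weight beyond. -/
theorem modeZ_of_l2_of_sup {γ : ℝ} (hγ : 0 < γ) {δ : ℝ} (hδ : 0 < δ) (hδ1 : δ < 1) (c : ℝ)
    {A : ENNReal} {g : ℝ → ENNReal} (mg : Measurable g) (h2 : l2 volume g ≤ A)
    (hsup : ∀ x, g x ≤ ENNReal.ofReal (δ ^ (1 / 2 : ℝ)) * A) :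
    ModeZ c ((∫⁻ x, japW (-1 - γ) x) * ENNReal.ofReal (δ ^ (1 / 2 - γ)) * A
      + 3 * ENNReal.ofReal (δ ^ (1 / 2 - γ)) * A
      + ENNReal.ofReal (δ ^ (1 / 2 - γ)) * A) g := by
  set I := ∫⁻ x, japW (-1 - γ) x
  set e := ENNReal.ofReal (δ ^ (1 / 2 - γ)) with he
  have hle : ENNReal.ofReal (δ ^ (1 / 2 : ℝ)) ≤ e := ofReal_rpow_le hδ hδ1 (by linarith)
  have h1 : ∫⁻ x, japW (-1) (x + c) * g x ≤ I * e * A + 3 * e * A := by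
    calc ∫⁻ x, japW (-1) (x + c) * g x
        ≤ ∫⁻ x, (ENNReal.ofReal (δ ^ (-γ)) * (ENNReal.ofReal (δ ^ (1 / 2 : ℝ)) * A))
            * japW (-1 - γ) (x + c) + tailW δ⁻¹ (x + c) * g x := by
          refine lintegral_mono fun x => ?_
          refine (mul_le_mul_left (japW_neg_one_le hδ hγ (x + c)) _).trans ?_
          rw [add_mul, ← mul_assoc (ENNReal.ofReal _), mul_right_comm (ENNReal.ofReal _ * _),
            mul_right_comm (ENNReal.ofReal _) _ (japW _ _), mul_assoc (ENNReal.ofReal _ * japW _ _)]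
          exact add_le_add (mul_le_mul_right (hsup x) _) le_rfl
      _ = e * A * I + ∫⁻ x, tailW δ⁻¹ (x + c) * g x := by
          rw [lintegral_add_left (by fun_prop), lintegral_const_mul _ (by fun_prop),
            lintegral_add_right_eq_self (fun x => japW (-1 - γ) x) c, ← mul_assoc (ENNReal.ofReal _),
            ofReal_rpow_add hδ, neg_add_eq_sub]
      _ ≤ e * A * I + 3 * e * A := by
          gcongr
          refine (lintegral_mul_le_l2 (by fun_prop) (by fun_prop)).trans ?_
          refine mul_le_mul' ((l2_tailW_le (inv_pos.2 hδ) c).trans ?_) h2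
          rw [inv_inv]
          gcongr
      _ = _ := by ring
  refine ⟨h1.trans le_self_add, ?_⟩
  -- The square of the `L²` piece is at most the sup of `g` times the `L¹` piece. The last summand
  -- of the bound guarantees that the sum dominates `e * A`.
  rw [l2_le_iff]
  calc ∫⁻ x, (japW (-1 / 2) (x + c) * g x) ^ 2
      ≤ ∫⁻ x, (e * A) * (japW (-1) (x + c) * g x) := by
        refine lintegral_mono fun x => ?_
        rw [mul_pow, japW_neg_half_sq, sq (g x), ← mul_assoc, mul_comm]
        gcongr
        exact (hsup x).trans (by gcongr)
    _ ≤ (e * A) * (I * e * A + 3 * e * A) := by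
        rw [lintegral_const_mul _ (by fun_prop)]
        gcongr
    _ ≤ _ := by
        rw [sq]
        exact mul_le_mul' le_add_self le_self_add

/-- Serves the case where the output modulation is large: both weights then yield `M^{-1/2}`, and
the power of `δ` is already in the `L²` norm of `g`. -/
theorem modeZ_tail {γ : ℝ} (hγ : 0 < γ) {δ : ℝ} (hδ : 0 < δ) (hδ1 : δ < 1) (c : ℝ)
    {M : ℝ} (hM : 0 < M) {A : ENNReal} {g : ℝ → ENNReal} (mg : Measurable g)
    (h2 : l2 volume g ≤ ENNReal.ofReal (δ ^ (1 / 2 : ℝ)) * A) :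
    ModeZ c (3 * ENNReal.ofReal (M⁻¹ ^ (1 / 2 : ℝ)) * (ENNReal.ofReal (δ ^ (1 / 2 - γ)) * A))
      (fun x => {x | M ≤ bracket (x + c)}.indicator g x) := by
  have hle : ENNReal.ofReal (δ ^ (1 / 2 : ℝ)) ≤ ENNReal.ofReal (δ ^ (1 / 2 - γ)) :=
    ofReal_rpow_le hδ hδ1 (by linarith)
  have h2' := h2.trans (mul_le_mul_left hle A)
  constructor
  · have e : ∀ x, japW (-1) (x + c) * {x | M ≤ bracket (x + c)}.indicator g x
        = tailW M (x + c) * g x := fun x => by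
      by_cases hx : M ≤ bracket (x + c)
      · rw [tailW, Set.indicator_of_mem (by exact hx), Set.indicator_of_mem (by exact hx)]
      · rw [tailW, Set.indicator_of_notMem (by exact hx), Set.indicator_of_notMem (by exact hx)]
        simp
    simp_rw [e]
    exact (lintegral_mul_le_l2 (by fun_prop) (by fun_prop)).trans
      (mul_le_mul' (l2_tailW_le hM c) h2')
  · have e : ∀ x, japW (-1 / 2) (x + c) * {x | M ≤ bracket (x + c)}.indicator g x
        ≤ ENNReal.ofReal (M⁻¹ ^ (1 / 2 : ℝ)) * g x := fun x => by
      by_cases hx : M ≤ bracket (x + c)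
      · rw [Set.indicator_of_mem (by exact hx)]
        gcongr
        refine ENNReal.ofReal_le_ofReal ?_
        rw [Real.inv_rpow hM.le, ← Real.rpow_neg hM.le, neg_div]
        exact Real.rpow_le_rpow_of_nonpos hM hx (by norm_num)
      · rw [Set.indicator_of_notMem (by exact hx)]
        simp
    refine (l2_mono e).trans ?_
    rw [l2_const_mul (by fun_prop)]
    refine mul_le_mul' ?_ h2'
    exact le_mul_of_one_le_left' (by norm_num)

/-! ### Interaction of two modes through the largest modulation. -/

theorem conv_le_resonance {c c₁ c₂ M : ℝ} (hM : 0 < M) (hD : 3 * M ≤ |c - c₁ - c₂|)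
    {a₁ a₂ : ℝ → ENNReal} (h₁ : Measurable a₁) (h₂ : Measurable a₂) (x : ℝ) :
    conv a₁ a₂ x ≤ {x | M ≤ bracket (x + c)}.indicator (conv a₁ a₂) x +
      ENNReal.ofReal (M⁻¹ ^ (1 / 2 : ℝ)) *
        (conv (fun y => japW (1 / 2) (y + c₁) * a₁ y) a₂ x
          + conv a₁ (fun y => japW (1 / 2) (y + c₂) * a₂ y) x) := by
  by_cases hx : M ≤ bracket (x + c)
  · rw [Set.indicator_of_mem (by exact hx)]
    exact le_self_add
  · refine le_add_left ?_
    unfold conv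
    rw [← lintegral_add_left (by fun_prop), ← lintegral_const_mul _ (by fun_prop)]
    refine lintegral_mono fun y => ?_
    have key : ∀ z, M ≤ bracket z →
        1 ≤ ENNReal.ofReal (M⁻¹ ^ (1 / 2 : ℝ)) * japW (1 / 2) z := fun z hz => by
      rw [japW, ← ENNReal.ofReal_mul (by positivity), ENNReal.one_le_ofReal,
        ← Real.mul_rpow (by positivity) (bracket_pos z).le]
      refine Real.one_le_rpow ?_ (by norm_num)
      rw [inv_mul_eq_div, one_le_div hM]
      exact hz
    -- The modulations satisfy `(x + c) - (y + c₁) - (x - y + c₂) = c - c₁ - c₂`, so they cannot all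
    -- be below `M`; the output one already is.
    have h3 : M ≤ bracket (y + c₁) ∨ M ≤ bracket (x - y + c₂) := by
      by_contra! h
      have e : c - c₁ - c₂ = (x + c) - (y + c₁) - (x - y + c₂) := by ring
      have b1 := (abs_le_bracket (x + c)).trans_lt (not_le.1 hx)
      have b2 := (abs_le_bracket (y + c₁)).trans_lt h.1
      have b3 := (abs_le_bracket (x - y + c₂)).trans_lt h.2
      rw [e] at hD
      have := abs_sub ((x + c) - (y + c₁)) (x - y + c₂)
      have := abs_sub (x + c) (y + c₁)
      linarith
    rcases h3 with h | h
    · calc a₁ y * a₂ (x - y) ≤ (ENNReal.ofReal (M⁻¹ ^ (1 / 2 : ℝ)) * japW (1 / 2) (y + c₁))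
            * (a₁ y * a₂ (x - y)) := le_mul_of_one_le_left' (key _ h)
        _ = ENNReal.ofReal (M⁻¹ ^ (1 / 2 : ℝ)) * (japW (1 / 2) (y + c₁) * a₁ y * a₂ (x - y)) := by
            ring
        _ ≤ _ := by gcongr; exact le_self_add
    · calc a₁ y * a₂ (x - y) ≤ (ENNReal.ofReal (M⁻¹ ^ (1 / 2 : ℝ)) * japW (1 / 2) (x - y + c₂))
            * (a₁ y * a₂ (x - y)) := le_mul_of_one_le_left' (key _ h)
        _ = ENNReal.ofReal (M⁻¹ ^ (1 / 2 : ℝ)) * (a₁ y * (japW (1 / 2) (x - y + c₂) * a₂ (x - y))) := by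
            ring
        _ ≤ _ := by gcongr; exact le_add_self

/-- In each of the three cases Young or Cauchy–Schwarz places the `δ^{1/2}` gain on an unweighted
factor. The constant collects `3` from the output tail and `I + 3 + 1` from each input case, with
`I` the integral of the weight. -/
theorem modeZ_conv {γ : ℝ} (hγ : 0 < γ) {δ : ℝ} (hδ : 0 < δ) (hδ1 : δ < 1) {c c₁ c₂ M : ℝ}
    (hM : 0 < M) (hD : 3 * M ≤ |c - c₁ - c₂|) {A₁ A₂ : ENNReal} {a₁ a₂ : ℝ → ENNReal}
    (h₁ : ModeBound δ c₁ A₁ a₁) (h₂ : ModeBound δ c₂ A₂ a₂) :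
    ModeZ c ((2 * (∫⁻ x, japW (-1 - γ) x) + 11) * ENNReal.ofReal (M⁻¹ ^ (1 / 2 : ℝ)) *
      (ENNReal.ofReal (δ ^ (1 / 2 - γ)) * (A₁ * A₂))) (conv a₁ a₂) := by
  have m₁ := h₁.meas
  have m₂ := h₂.meas
  have mw₁ : Measurable (fun y => japW (1 / 2) (y + c₁) * a₁ y) := by fun_prop
  have mw₂ : Measurable (fun y => japW (1 / 2) (y + c₂) * a₂ y) := by fun_prop
  have mc := measurable_conv m₁ m₂
  have mc₁ := measurable_conv mw₁ m₂
  have mc₂ := measurable_conv m₁ mw₂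
  have t0 := modeZ_tail (A := A₁ * A₂) hγ hδ hδ1 c hM mc ((l2_conv_le m₁ m₂).trans
    ((mul_le_mul' h₁.one h₂.two).trans_eq (by ring)))
  have t1 := modeZ_of_l2_of_sup (A := A₁ * A₂) hγ hδ hδ1 c mc₁
    (by
      rw [conv_comm]
      exact (l2_conv_le m₂ mw₁).trans ((mul_le_mul' h₂.one h₁.half).trans_eq (by ring)))
    (fun x => (conv_le_l2 mw₁ m₂ x).trans ((mul_le_mul' h₁.half h₂.two).trans_eq (by ring)))
  have t2 := modeZ_of_l2_of_sup (A := A₁ * A₂) hγ hδ hδ1 c mc₂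
    ((l2_conv_le m₁ mw₂).trans (mul_le_mul' h₁.one h₂.half))
    (fun x => (conv_le_l2 m₁ mw₂ x).trans ((mul_le_mul' h₁.two h₂.half).trans_eq (by ring)))
  have ms : MeasurableSet {x | M ≤ bracket (x + c)} :=
    measurableSet_le measurable_const (continuous_bracket.measurable.comp (by fun_prop))
  refine (t0.add ((t1.add t2 mc₁ mc₂).const_mul (mc₁.add mc₂)
    (ENNReal.ofReal (M⁻¹ ^ (1 / 2 : ℝ)))) (mc.indicator ms) ((mc₁.add mc₂).const_mul _)).mono
    (le_of_eq ?_) (conv_le_resonance hM hD m₁ m₂)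
  ring

/-! ### Lower bound for the resonance function and control of the symbol. -/

theorem add_pow_sub_ge {x y : ℝ} (hx : 0 ≤ x) (hy : 0 ≤ y) (n : ℕ) :
    x ^ (n + 2) + y ^ (n + 2) + x * y * (x + y) ^ n ≤ (x + y) ^ (n + 2) := by
  induction n with
  | zero => norm_num; nlinarith [mul_nonneg hx hy]
  | succ n ih =>
    have h := mul_le_mul_of_nonneg_left ih (add_nonneg hx hy)
    have h1 : 0 ≤ x * y ^ (n + 2) := by positivity
    have h2 : 0 ≤ y * x ^ (n + 2) := by positivity
    calc x ^ (n + 1 + 2) + y ^ (n + 1 + 2) + x * y * (x + y) ^ (n + 1)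
        ≤ (x + y) * (x ^ (n + 2) + y ^ (n + 2) + x * y * (x + y) ^ n) := by
          ring_nf at h1 h2 ⊢; linarith
      _ ≤ (x + y) * (x + y) ^ (n + 2) := h
      _ = (x + y) ^ (n + 1 + 2) := by ring

/-- The first bound serves frequencies of equal sign. The second, where the sum plays the role of an
input, serves opposite signs after the negative frequency is moved to the other side. -/
theorem resonance_of_nonneg {x y : ℝ} (hx : 0 ≤ x) (hy : 0 ≤ y) (i : ℕ) :
    (x * y) ^ (i + 1) * (x + y) ≤ (x + y) ^ (2 * (i + 1) + 1) - x ^ (2 * (i + 1) + 1)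
        - y ^ (2 * (i + 1) + 1) ∧
      ((x + y) * y) ^ (i + 1) * x ≤ (x + y) ^ (2 * (i + 1) + 1) - x ^ (2 * (i + 1) + 1)
        - y ^ (2 * (i + 1) + 1) := by
  have h := add_pow_sub_ge hx hy (2 * i + 1)
  rw [show 2 * i + 1 + 2 = 2 * (i + 1) + 1 by ring] at h
  have hxy : x * y ≤ (x + y) ^ 2 := by nlinarith [mul_nonneg hx hy, sq_nonneg x, sq_nonneg y]
  have e1 : (x * y) ^ (i + 1) * (x + y) ≤ x * y * (x + y) ^ (2 * i + 1) := by
    calc (x * y) ^ (i + 1) * (x + y) = (x * y) * (x + y) * (x * y) ^ i := by ring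
      _ ≤ (x * y) * (x + y) * ((x + y) ^ 2) ^ i := by gcongr
      _ = _ := by rw [← pow_mul]; ring
  have e2 : ((x + y) * y) ^ (i + 1) * x ≤ x * y * (x + y) ^ (2 * i + 1) := by
    calc ((x + y) * y) ^ (i + 1) * x = x * y * ((x + y) ^ (i + 1) * y ^ i) := by
          rw [mul_pow]; ring
      _ ≤ x * y * ((x + y) ^ (i + 1) * (x + y) ^ i) := by gcongr; linarith
      _ = _ := by rw [← pow_add]; ring_nf
  constructor <;> linarith

/-- Oddness of the power and symmetry in `x`, `y` reduce to `0 ≤ x + y` and `y ≤ x`. If `y < 0`,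
then `x = (x + y) + (-y)` is a sum of nonnegative numbers. -/
theorem resonance (i : ℕ) (x y : ℝ) :
    |x * y| ^ (i + 1) * |x + y| ≤
      |(x + y) ^ (2 * (i + 1) + 1) - x ^ (2 * (i + 1) + 1) - y ^ (2 * (i + 1) + 1)| := by
  have hodd : Odd (2 * (i + 1) + 1) := ⟨i + 1, rfl⟩
  wlog hxy : 0 ≤ x + y generalizing x y
  · have h := this (-x) (-y) (by linarith)
    rw [neg_mul_neg, ← neg_add, abs_neg (x + y), hodd.neg_pow, hodd.neg_pow, hodd.neg_pow] at h
    refine h.trans_eq ?_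
    rw [← abs_neg]; congr 1; ring
  wlog hle : y ≤ x generalizing x y
  · have h := this y x (by linarith) (le_of_not_ge hle)
    rw [mul_comm x y, add_comm x y]
    refine h.trans_eq ?_
    congr 1; ring
  have hx : 0 ≤ x := by linarith
  rw [abs_of_nonneg hxy]
  rcases le_total 0 y with hy | hy
  · rw [abs_of_nonneg (mul_nonneg hx hy)]
    exact (resonance_of_nonneg hx hy i).1.trans (le_abs_self _)
  · have h := (resonance_of_nonneg hxy (neg_nonneg.2 hy) i).2
    rw [add_neg_cancel_right, hodd.neg_pow] at h
    rw [abs_of_nonpos (mul_nonpos_of_nonneg_of_nonpos hx hy), ← mul_neg]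
    exact (h.trans_eq (by ring)).trans (neg_le_abs _)

theorem bracket_add_le_mul (x y : ℝ) : bracket (x + y) ≤ 2 * (bracket x * bracket y) := by
  have h1 := one_le_bracket x
  have h2 := one_le_bracket y
  have h3 := bracket_add_le x y
  have h4 := abs_le_bracket y
  nlinarith

theorem bracket_le_two_mul_abs {k : ℤ} (hk : k ≠ 0) : bracket k ≤ 2 * |(k : ℝ)| := by
  have h : (1 : ℝ) ≤ |(k : ℝ)| := by exact_mod_cast Int.one_le_abs hk
  refine Real.sqrt_le_iff.2 ⟨by positivity, ?_⟩
  nlinarith [sq_abs (k : ℝ)]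

theorem bracket_pow_resonance {j : ℕ} (hj : 1 ≤ j) {k k₁ k₂ : ℤ} (hk : k ≠ 0) (h₁ : k₁ ≠ 0)
    (h₂ : k₂ ≠ 0) (h : k = k₁ + k₂) :
    (bracket k₁ * bracket k₂) ^ j * bracket k ^ 2 ≤
      (2 * 4 ^ j) * |(k : ℝ) ^ (2 * j + 1) - (k₁ : ℝ) ^ (2 * j + 1) - (k₂ : ℝ) ^ (2 * j + 1)|
        * bracket k ^ j := by
  obtain ⟨i, rfl⟩ : ∃ i, j = i + 1 := ⟨j - 1, by omega⟩
  have hr := resonance i k₁ k₂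
  have hk' : (k : ℝ) = k₁ + k₂ := by exact_mod_cast h
  rw [← hk'] at hr
  have b := bracket_pos k
  have b₁ := bracket_pos k₁
  have b₂ := bracket_pos k₂
  calc (bracket k₁ * bracket k₂) ^ (i + 1) * bracket k ^ 2
      ≤ ((2 * |(k₁ : ℝ)|) * (2 * |(k₂ : ℝ)|)) ^ (i + 1) * ((2 * |(k : ℝ)|) * bracket k) := by
        rw [sq]
        gcongr <;> exact bracket_le_two_mul_abs (by assumption)
    _ = (2 * 4 ^ (i + 1)) * (|(k₁ : ℝ) * k₂| ^ (i + 1) * |(k : ℝ)|) * bracket k := by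
        rw [abs_mul, show (2 * |(k₁ : ℝ)|) * (2 * |(k₂ : ℝ)|) = 4 * (|(k₁ : ℝ)| * |(k₂ : ℝ)|) by ring,
          mul_pow]
        ring
    _ ≤ _ := by
        gcongr
        exact le_self_pow₀ (one_le_bracket _) (by omega)

/-- Control of the symbol `k k₁ k₂ / (1 + k²)` by the square root of the resonance function. -/
theorem symbol_le {j : ℕ} (hj : 1 ≤ j) {s : ℝ} (hs : (2 - (j : ℝ)) / 2 ≤ s) :
    ∃ C : ℝ, 0 < C ∧ ∀ k k₁ k₂ : ℤ, k ≠ 0 → k₁ ≠ 0 → k₂ ≠ 0 → k = k₁ + k₂ →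
      bracket k ^ s * (|(k : ℝ)| * |(k₁ : ℝ)| * |(k₂ : ℝ)| / (1 + (k : ℝ) ^ 2)) ≤
        C * |(k : ℝ)|⁻¹ * (bracket k₁ ^ s * bracket k₂ ^ s) *
          |(k : ℝ) ^ (2 * j + 1) - (k₁ : ℝ) ^ (2 * j + 1) - (k₂ : ℝ) ^ (2 * j + 1)| ^ (1 / 2 : ℝ) := by
  refine ⟨2 ^ (s - 1 + j / 2) * (2 * 4 ^ j : ℝ) ^ (1 / 2 : ℝ), by positivity,
    fun k k₁ k₂ hk h₁ h₂ h => ?_⟩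
  have hres := bracket_pow_resonance hj hk h₁ h₂ h
  set D := |(k : ℝ) ^ (2 * j + 1) - (k₁ : ℝ) ^ (2 * j + 1) - (k₂ : ℝ) ^ (2 * j + 1)| with hD
  have hD0 : 0 ≤ D := abs_nonneg _
  have hk' : (k : ℝ) = k₁ + k₂ := by exact_mod_cast h
  have hpe : bracket k ≤ 2 * (bracket k₁ * bracket k₂) := by
    rw [hk']; exact bracket_add_le_mul _ _
  have e₁ := abs_le_bracket k₁
  have e₂ := abs_le_bracket k₂
  have e := abs_le_bracket k
  have b := bracket_pos k
  have b₁ := bracket_pos k₁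
  have b₂ := bracket_pos k₂
  have hka : 0 < |(k : ℝ)| := by positivity
  rw [← bracket_sq]
  set B := bracket k
  set P := bracket k₁ * bracket k₂ with hP
  have hP0 : 0 < P := by positivity
  rw [← Real.mul_rpow b₁.le b₂.le, ← hP]
  -- the exponent `s - 1` may be replaced by `-j/2`
  have hq : (B / P) ^ (s - 1) ≤ 2 ^ (s - 1 + j / 2) * (P / B) ^ ((j : ℝ) / 2) := by
    have : B / P ≤ 2 := by rw [div_le_iff₀ hP0]; exact hpe
    have h3 : (B / P) ^ (s - 1 + j / 2) ≤ 2 ^ (s - 1 + j / 2) :=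
      Real.rpow_le_rpow (by positivity) this (by linarith)
    have h4 : (B / P) ^ (s - 1) = (B / P) ^ (s - 1 + j / 2) * (P / B) ^ ((j : ℝ) / 2) := by
      rw [← inv_div B P, Real.inv_rpow (by positivity), ← Real.rpow_neg (by positivity),
        ← Real.rpow_add (by positivity)]
      congr 1; ring
    rw [h4]
    gcongr
  -- Squared, this is the resonance bound `P^j B² ≤ 2 · 4^j D B^j`.
  have hD' : B * (P / B) ^ ((j : ℝ) / 2) ≤ (2 * 4 ^ j : ℝ) ^ (1 / 2 : ℝ) * D ^ (1 / 2 : ℝ) := by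
    rw [← Real.mul_rpow (by positivity) hD0]
    rw [← Real.sqrt_eq_rpow]
    refine Real.le_sqrt_of_sq_le ?_
    rw [mul_pow, ← Real.rpow_natCast _ 2, ← Real.rpow_natCast _ 2, ← Real.rpow_mul (by positivity),
      show (j : ℝ) / 2 * (2 : ℕ) = j by push_cast; ring, Real.rpow_natCast, Real.rpow_natCast,
      div_pow, mul_div_assoc', div_le_iff₀ (by positivity), mul_comm]
    exact hres
  have hBP : B ^ s * P = B * (B / P) ^ (s - 1) * P ^ s := by
    rw [Real.div_rpow b.le hP0.le, Real.rpow_sub_one b.ne', Real.rpow_sub_one hP0.ne']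
    field_simp
  calc B ^ s * (|(k : ℝ)| * |(k₁ : ℝ)| * |(k₂ : ℝ)| / B ^ 2)
      = |(k : ℝ)|⁻¹ * (B ^ s * (|(k : ℝ)| ^ 2 * (|(k₁ : ℝ)| * |(k₂ : ℝ)|) / B ^ 2)) := by
        field_simp
    _ ≤ |(k : ℝ)|⁻¹ * (B ^ s * (B ^ 2 * P / B ^ 2)) := by
        have := mul_le_mul e₁ e₂ (abs_nonneg _) b₁.le
        gcongr
    _ = |(k : ℝ)|⁻¹ * (B * (B / P) ^ (s - 1) * P ^ s) := by
        rw [mul_div_cancel_left₀ _ (by positivity), hBP]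
    _ ≤ |(k : ℝ)|⁻¹ * (B * (2 ^ (s - 1 + j / 2) * (P / B) ^ ((j : ℝ) / 2)) * P ^ s) := by gcongr
    _ = |(k : ℝ)|⁻¹ * (2 ^ (s - 1 + j / 2) * (B * (P / B) ^ ((j : ℝ) / 2)) * P ^ s) := by ring
    _ ≤ |(k : ℝ)|⁻¹ * (2 ^ (s - 1 + j / 2) * ((2 * 4 ^ j : ℝ) ^ (1 / 2 : ℝ) * D ^ (1 / 2 : ℝ))
          * P ^ s) := by gcongr
    _ = _ := by ring

/-! ### Summation over the frequencies. -/

/-- The dispersion relation. -/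
def disp (j : ℕ) (k : ℤ) : ℝ := (k : ℝ) ^ (2 * j + 1)

/-- The weighted symbol `⟨k⟩^s |k k₁ k₂| / (1 + k²)`. -/
noncomputable def symb (s : ℝ) (k k₁ k₂ : ℤ) : ℝ :=
  bracket k ^ s * (|(k : ℝ)| * |(k₁ : ℝ)| * |(k₂ : ℝ)| / (1 + (k : ℝ) ^ 2))

/-- `⟨k⟩^s` times the `Y` norm of the mode `k`. -/
noncomputable def weightedMode (j : ℕ) (s : ℝ) (f : ℤ → ℝ → ENNReal) (k : ℤ) : ENNReal :=
  ENNReal.ofReal (bracket k ^ s) * modeY (disp j k) (f k)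

theorem resonance_pos {j : ℕ} (hj : 1 ≤ j) {k k₁ k₂ : ℤ} (hk : k ≠ 0) (h₁ : k₁ ≠ 0)
    (h₂ : k₂ ≠ 0) (h : k = k₁ + k₂) : 0 < |disp j k - disp j k₁ - disp j k₂| := by
  have hres := bracket_pow_resonance hj hk h₁ h₂ h
  by_contra h0
  have h0 : |disp j k - disp j k₁ - disp j k₂| = 0 := le_antisymm (not_lt.1 h0) (abs_nonneg _)
  unfold disp at h0
  rw [h0, mul_zero, zero_mul] at hres
  have b := bracket_pos k
  have b₁ := bracket_pos k₁
  have b₂ := bracket_pos k₂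
  exact absurd hres (not_le.2 (by positivity))

theorem exists_modeZ_pair {j : ℕ} (hj : 1 ≤ j) {s : ℝ} (hs : (2 - (j : ℝ)) / 2 ≤ s)
    {γ : ℝ} (hγ : 0 < γ) :
    ∃ C : ENNReal, C ≠ ⊤ ∧ ∀ δ : ℝ, 0 < δ → δ < 1 → ∀ k k₁ k₂ : ℤ, k ≠ 0 → k = k₁ + k₂ →
      ∀ f₁ f₂ : ℤ → ℝ → ENNReal, (∀ k, Measurable (f₁ k)) → (∀ k, Measurable (f₂ k)) →
        ModeZ (disp j k) (C * ENNReal.ofReal (δ ^ (1 / 2 - γ)) * ENNReal.ofReal |(k : ℝ)|⁻¹ *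
          (({0}ᶜ : Set ℤ).indicator (weightedMode j s f₁) k₁ *
            ({0}ᶜ : Set ℤ).indicator (weightedMode j s f₂) k₂))
          (fun x => ENNReal.ofReal (symb s k k₁ k₂) *
            conv (smear δ (f₁ k₁)) (smear δ (f₂ k₂)) x) := by
  obtain ⟨C₀, hC₀, hsym⟩ := symbol_le hj hs
  -- `32 = 4 · 4 · 2`: a factor `4` from localizing each input, and `√3 ≤ 2` from `D^{1/2}
  -- (D/3)^{-1/2}`.
  refine ⟨32 * (2 * (∫⁻ x, japW (-1 - γ) x) + 11) * ENNReal.ofReal C₀, ?_, ?_⟩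
  · have := (lintegral_japW_lt_top hγ).ne
    finiteness
  intro δ hδ hδ1 k k₁ k₂ hk h f₁ f₂ hf₁ hf₂
  -- Zero modes are not controlled by the norms, but the symbol vanishes there; hence the indicators
  -- in the bound.
  by_cases hz : k₁ = 0 ∨ k₂ = 0
  · have : symb s k k₁ k₂ = 0 := by
      rcases hz with rfl | rfl <;> simp [symb]
    constructor <;> simp [this, l2]
  · push Not at hz
    obtain ⟨h₁, h₂⟩ := hz
    rw [Set.indicator_of_mem (by simpa using h₁), Set.indicator_of_mem (by simpa using h₂)]
    have hD := resonance_pos hj hk h₁ h₂ h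
    have hs := hsym k k₁ k₂ hk h₁ h₂ h
    change symb s k k₁ k₂ ≤ C₀ * |(k : ℝ)|⁻¹ * (bracket k₁ ^ s * bracket k₂ ^ s) *
      |disp j k - disp j k₁ - disp j k₂| ^ (1 / 2 : ℝ) at hs
    set D := |disp j k - disp j k₁ - disp j k₂|
    have b₁ := bracket_pos k₁
    have b₂ := bracket_pos k₂
    have key : ENNReal.ofReal (symb s k k₁ k₂) * ENNReal.ofReal ((D / 3)⁻¹ ^ (1 / 2 : ℝ)) ≤
        ENNReal.ofReal C₀ * ENNReal.ofReal |(k : ℝ)|⁻¹ * (ENNReal.ofReal (bracket k₁ ^ s)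
          * ENNReal.ofReal (bracket k₂ ^ s)) * 2 := by
      rw [show (2 : ENNReal) = ENNReal.ofReal 2 by simp, ← ENNReal.ofReal_mul' (by positivity),
        ← ENNReal.ofReal_mul (by positivity), ← ENNReal.ofReal_mul (by positivity),
        ← ENNReal.ofReal_mul (by positivity), ← ENNReal.ofReal_mul (by positivity)]
      refine ENNReal.ofReal_le_ofReal ?_
      have h3 : D ^ (1 / 2 : ℝ) * (D / 3)⁻¹ ^ (1 / 2 : ℝ) ≤ 2 := by
        rw [← Real.mul_rpow hD.le (by positivity), show D * (D / 3)⁻¹ = 3 by field_simp,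
          ← Real.sqrt_eq_rpow]
        exact Real.sqrt_le_iff.2 (by norm_num)
      calc symb s k k₁ k₂ * (D / 3)⁻¹ ^ (1 / 2 : ℝ)
          ≤ (C₀ * |(k : ℝ)|⁻¹ * (bracket k₁ ^ s * bracket k₂ ^ s) * D ^ (1 / 2 : ℝ))
              * (D / 3)⁻¹ ^ (1 / 2 : ℝ) := by gcongr
        _ = (C₀ * |(k : ℝ)|⁻¹ * (bracket k₁ ^ s * bracket k₂ ^ s)) *
              (D ^ (1 / 2 : ℝ) * (D / 3)⁻¹ ^ (1 / 2 : ℝ)) := by ring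
        _ ≤ _ := by gcongr
    have hp := modeZ_conv hγ hδ hδ1 (M := D / 3) (by positivity)
      (show 3 * (D / 3) ≤ |disp j k - disp j k₁ - disp j k₂| by linarith)
      (modeBound_smear hδ (disp j k₁) (hf₁ k₁)) (modeBound_smear hδ (disp j k₂) (hf₂ k₂))
    refine (hp.const_mul (measurable_conv (measurable_smear (hf₁ _)) (measurable_smear (hf₂ _)))
      (ENNReal.ofReal (symb s k k₁ k₂))).mono ?_ fun _ => le_rfl
    set I := 2 * (∫⁻ x, japW (-1 - γ) x) + 11
    set e := ENNReal.ofReal (δ ^ (1 / 2 - γ))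
    unfold weightedMode
    set y₁ := modeY (disp j k₁) (f₁ k₁)
    set y₂ := modeY (disp j k₂) (f₂ k₂)
    calc _ = (16 * I * e * (y₁ * y₂)) * (ENNReal.ofReal (symb s k k₁ k₂) *
            ENNReal.ofReal ((D / 3)⁻¹ ^ (1 / 2 : ℝ))) := by ring
      _ ≤ _ := mul_le_mul_right key _
      _ = _ := by ring

theorem ModeZ.tsum {ι : Type*} [Countable ι] {c : ℝ} {A : ι → ENNReal} {g : ι → ℝ → ENNReal}
    (h : ∀ i, ModeZ c (A i) (g i)) (mg : ∀ i, Measurable (g i)) :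
    ModeZ c (∑' i, A i) (fun x => ∑' i, g i x) where
  one := by
    simp_rw [← ENNReal.tsum_mul_left]
    rw [lintegral_tsum fun i => by fun_prop]
    exact ENNReal.tsum_le_tsum fun i => (h i).one
  two := by
    simp_rw [← ENNReal.tsum_mul_left]
    exact (l2_tsum_le fun i => by fun_prop).trans (ENNReal.tsum_le_tsum fun i => (h i).two)

/-- The `ℓ²` sum over nonzero frequencies of the weighted modes. -/
noncomputable def modesNorm (j : ℕ) (s : ℝ) (f : ℤ → ℝ → ENNReal) : ENNReal :=
  (∑' k : {k : ℤ // k ≠ 0}, weightedMode j s f k ^ 2) ^ (1 / 2 : ℝ)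

theorem l2_count_indicator (z : ℤ → ENNReal) :
    l2 Measure.count (({0}ᶜ : Set ℤ).indicator z) =
      (∑' k : {k : ℤ // k ≠ 0}, z k ^ 2) ^ (1 / 2 : ℝ) := by
  rw [l2_count]
  congr 1
  have h := tsum_subtype ({0}ᶜ : Set ℤ) (fun k => z k ^ 2)
  refine Eq.trans (tsum_congr fun k => ?_) h.symm
  by_cases hk : k = 0 <;> simp [Set.indicator, hk]

theorem tsum_mul_sub_le (z₁ z₂ : ℤ → ENNReal) (k : ℤ) :
    ∑' k₁, z₁ k₁ * z₂ (k - k₁) ≤ l2 Measure.count z₁ * l2 Measure.count z₂ := by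
  have h := lintegral_mul_le_l2 (μ := Measure.count) (f := z₁) (g := fun k₁ => z₂ (k - k₁))
    (measurable_of_countable _).aemeasurable (measurable_of_countable _).aemeasurable
  rw [lintegral_count] at h
  refine h.trans_eq ?_
  rw [l2_count z₂, l2_count fun k₁ => z₂ (k - k₁)]
  congr 2
  exact (Equiv.subLeft k).tsum_eq fun k => z₂ k ^ 2

/-- Minkowski in `k₁`, then Cauchy–Schwarz in `k₁`. The latter uses up both `ℓ²` norms, so summing
over `k` rests on the factor `|k|⁻¹` alone. -/
theorem exists_modeZ {j : ℕ} (hj : 1 ≤ j) {s : ℝ} (hs : (2 - (j : ℝ)) / 2 ≤ s)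
    {γ : ℝ} (hγ : 0 < γ) :
    ∃ C : ENNReal, C ≠ ⊤ ∧ ∀ δ : ℝ, 0 < δ → δ < 1 →
      ∀ f₁ f₂ : ℤ → ℝ → ENNReal, (∀ k, Measurable (f₁ k)) → (∀ k, Measurable (f₂ k)) →
        ∀ k : ℤ, k ≠ 0 →
        ModeZ (disp j k) (C * ENNReal.ofReal (δ ^ (1 / 2 - γ)) *
          (modesNorm j s f₁ * modesNorm j s f₂) * ENNReal.ofReal |(k : ℝ)|⁻¹)
          (fun x => ∑' k₁ : ℤ, ENNReal.ofReal (symb s k k₁ (k - k₁)) *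
            conv (smear δ (f₁ k₁)) (smear δ (f₂ (k - k₁))) x) := by
  obtain ⟨C, hC, h⟩ := exists_modeZ_pair hj hs hγ
  refine ⟨C, hC, fun δ hδ hδ1 f₁ f₂ hf₁ hf₂ k hk => ?_⟩
  refine (ModeZ.tsum (fun k₁ => h δ hδ hδ1 k k₁ (k - k₁) hk (by ring) f₁ f₂ hf₁ hf₂)
    fun k₁ => (measurable_conv (measurable_smear (hf₁ _))
      (measurable_smear (hf₂ _))).const_mul _).mono ?_ fun _ => le_rfl
  rw [ENNReal.tsum_mul_left]
  refine (mul_le_mul_right (tsum_mul_sub_le _ _ k) _).trans_eq ?_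
  rw [l2_count_indicator, l2_count_indicator, modesNorm, modesNorm]
  ring

theorem tsum_inv_abs_sq_lt_top :
    (∑' k : {k : ℤ // k ≠ 0}, ENNReal.ofReal |((k : ℤ) : ℝ)|⁻¹ ^ 2) ^ (1 / 2 : ℝ) < ⊤ := by
  refine ENNReal.rpow_lt_top_of_nonneg (by norm_num) ?_
  have h : Summable fun k : {k : ℤ // k ≠ 0} => (|((k : ℤ) : ℝ)|⁻¹) ^ 2 := by
    have := (Real.summable_one_div_int_pow (p := 2)).2 (by norm_num)
    refine (this.subtype {k : ℤ | k ≠ 0}).congr fun k => ?_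
    simp
  simp_rw [← ENNReal.ofReal_pow (inv_nonneg.2 (abs_nonneg _))]
  exact h.tsum_ofReal_ne_top

theorem exists_normZHat_le {j : ℕ} (hj : 1 ≤ j) {s : ℝ} (hs : (2 - (j : ℝ)) / 2 ≤ s)
    {γ : ℝ} (hγ : 0 < γ) :
    ∃ C : ENNReal, C ≠ ⊤ ∧ ∀ δ : ℝ, 0 < δ → δ < 1 →
      ∀ f₁ f₂ : ℤ → ℝ → ENNReal, (∀ k, Measurable (f₁ k)) → (∀ k, Measurable (f₂ k)) →
        ∀ (B : ℤ → ℝ → ℂ) (r : ENNReal), (∀ k : ℤ, k ≠ 0 → ∀ x, ENNReal.ofReal (bracket k ^ s) * ‖B k x‖ₑ ≤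
          r * ∑' k₁ : ℤ, ENNReal.ofReal (symb s k k₁ (k - k₁)) *
            conv (smear δ (f₁ k₁)) (smear δ (f₂ (k - k₁))) x) →
        normZHat j s B ≤ C * r * ENNReal.ofReal (δ ^ (1 / 2 - γ)) *
          (modesNorm j s f₁ * modesNorm j s f₂) := by
  obtain ⟨C, hC, h⟩ := exists_modeZ hj hs hγ
  set S := (∑' k : {k : ℤ // k ≠ 0}, ENNReal.ofReal |((k : ℤ) : ℝ)|⁻¹ ^ 2) ^ (1 / 2 : ℝ) with hS
  have hS' : S ≠ ⊤ := tsum_inv_abs_sq_lt_top.ne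
  refine ⟨2 * C * S, by finiteness, fun δ hδ hδ1 f₁ f₂ hf₁ hf₂ B r hB => ?_⟩
  set X := C * ENNReal.ofReal (δ ^ (1 / 2 - γ)) * (modesNorm j s f₁ * modesNorm j s f₂) with hX
  have hm : ∀ k : ℤ, k ≠ 0 → ModeZ (disp j k) (r * (X * ENNReal.ofReal |(k : ℝ)|⁻¹))
      (fun x => ENNReal.ofReal (bracket k ^ s) * ‖B k x‖ₑ) := fun k hk =>
    ((h δ hδ hδ1 f₁ f₂ hf₁ hf₂ k hk).const_mul (Measurable.tsum fun k₁ =>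
      (measurable_conv (measurable_smear (hf₁ _)) (measurable_smear (hf₂ _))).const_mul _) r).mono
      le_rfl (hB k hk)
  have hw : ∀ (b : ℝ) (k : ℤ) (x : ℝ), ENNReal.ofReal (bracket (k : ℝ) ^ s *
      bracket (x + (k : ℝ) ^ (2 * j + 1)) ^ b) * ‖B k x‖ₑ
      = japW b (x + disp j k) * (ENNReal.ofReal (bracket k ^ s) * ‖B k x‖ₑ) := fun b k x => by
    have := bracket_pos k
    rw [ENNReal.ofReal_mul (by positivity), japW, disp]
    ring
  have hsum : ∀ T : {k : ℤ // k ≠ 0} → ENNReal,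
      (∀ k, T k ≤ (r * (X * ENNReal.ofReal |((k : ℤ) : ℝ)|⁻¹)) ^ 2) →
      (∑' k, T k) ^ (1 / 2 : ℝ) ≤ r * X * S := fun T hT => by
    calc (∑' k, T k) ^ (1 / 2 : ℝ)
        ≤ (∑' k : {k : ℤ // k ≠ 0}, (r * (X * ENNReal.ofReal |((k : ℤ) : ℝ)|⁻¹)) ^ 2)
            ^ (1 / 2 : ℝ) := by
          gcongr
          exact hT _
      _ = r * X * S := by
          simp_rw [← mul_assoc, mul_pow (r * X)]
          rw [ENNReal.tsum_mul_left, ENNReal.mul_rpow_of_nonneg _ _ (by norm_num), sqrt_sq_ennreal]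
  have h1 : weightedL2L2 j s (-1 / 2) B ≤ r * X * S := by
    refine hsum _ fun k => ?_
    simp_rw [hw]
    rw [← l2_sq]
    exact pow_le_pow_left' (hm k.1 k.2).two 2
  have h2 : weightedL2L1 j s (-1) B ≤ r * X * S := by
    refine hsum _ fun k => ?_
    simp_rw [hw]
    exact pow_le_pow_left' (hm k.1 k.2).one 2
  calc normZHat j s B ≤ r * X * S + r * X * S := add_le_add h1 h2
    _ = _ := by rw [hX]; ring

/-- Minkowski in `ℓ²(k)`: the left side adds the two pieces of the norm mode by mode, the right side
after summation. -/
theorem modesNorm_le_normYHat {j : ℕ} {s : ℝ} {f : ℤ → ℝ → ENNReal} {F : ℤ → ℝ → ℂ}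
    (hf : ∀ k, Measurable (f k)) (h : ∀ k : ℤ, k ≠ 0 → f k =ᵐ[volume] fun x => ‖F k x‖ₑ) :
    modesNorm j s f ≤ normYHat j s F := by
  have h1 : weightedL2L2 j s (1 / 2) F = l2 Measure.count fun k : {k : ℤ // k ≠ 0} =>
      ENNReal.ofReal (bracket (k : ℤ) ^ s) *
        l2 volume fun x => japW (1 / 2) (x + disp j k) * f k x := by
    rw [l2_count]
    unfold weightedL2L2
    congr 1
    refine tsum_congr fun k => ?_
    have := bracket_pos (k : ℤ)
    have mk := hf k.1
    rw [← l2_const_mul (by fun_prop), l2_sq]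
    refine lintegral_congr_ae ((h k.1 k.2).mono fun x hx => ?_)
    simp only [hx]
    rw [ENNReal.ofReal_mul (by positivity), japW, disp]
    ring
  have h2 : weightedL2L1 j s 0 F = l2 Measure.count fun k : {k : ℤ // k ≠ 0} =>
      ENNReal.ofReal (bracket (k : ℤ) ^ s) * ∫⁻ x, f k x := by
    rw [l2_count]
    unfold weightedL2L1
    congr 1
    refine tsum_congr fun k => ?_
    rw [← lintegral_const_mul _ (hf k.1)]
    congr 1
    refine lintegral_congr_ae ((h k.1 k.2).mono fun x hx => ?_)
    simp only [hx, Real.rpow_zero, mul_one]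
  rw [normYHat, h1, h2, modesNorm, ← l2_count]
  refine le_trans (l2_mono fun k => ?_) (l2_add_le (measurable_of_countable _).aemeasurable
    (measurable_of_countable _).aemeasurable)
  rw [weightedMode, modeY, mul_add]

/-! ### The space-time Fourier transform of a localized function. -/

open scoped FourierTransform SchwartzMap in
-- The Fourier transform of `η` is Schwartz, so quadratic decay suffices; scaling by `δ` makes the
-- constant uniform. The factors `2π` convert from the transform with phase `e^{-2πixξ}`.
theorem exists_cutoff_fourier_le {η : ℝ → ℝ} (hη : ContDiff ℝ ((⊤ : ℕ∞) : WithTop ℕ∞) η)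
    (hc : HasCompactSupport η) :
    ∃ C : ℝ, 0 ≤ C ∧ ∀ δ : ℝ, 0 < δ → ∀ τ : ℝ,
      ‖(2 * Real.pi : ℂ)⁻¹ * ∫ t : ℝ, Complex.exp (-(Complex.I * t * τ)) * (η (t / δ) : ℝ)‖ ≤
        C * (δ / (1 + (δ * τ) ^ 2)) := by
  have hg : HasCompactSupport (fun t => (η t : ℂ)) := hc.comp_left (g := fun x : ℝ => (x : ℂ)) rfl
  let φ : 𝓢(ℝ, ℂ) := hg.toSchwartzMap (Complex.ofRealCLM.contDiff.comp hη)
  obtain ⟨A, hA0, hA⟩ : ∃ A : ℝ, 0 ≤ A ∧ ∀ ξ : ℝ, (1 + ‖ξ‖) ^ 2 * ‖(𝓕 φ : 𝓢(ℝ, ℂ)) ξ‖ ≤ A := by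
    have h := fun ξ : ℝ => SchwartzMap.one_add_le_sup_seminorm_apply (𝕜 := ℝ) (m := (2, 0)) (k := 2)
      (n := 0) le_rfl le_rfl (𝓕 φ : 𝓢(ℝ, ℂ)) ξ
    simp only [norm_iteratedFDeriv_zero] at h
    exact ⟨_, le_trans (by positivity) (h 0), h⟩
  refine ⟨(2 * Real.pi)⁻¹ * (A * (2 * Real.pi) ^ 2), by positivity, fun δ hδ τ => ?_⟩
  have hF : ∫ t : ℝ, Complex.exp (-(Complex.I * t * τ)) * (η (t / δ) : ℝ)
      = δ * (𝓕 φ : 𝓢(ℝ, ℂ)) (δ * τ / (2 * Real.pi)) := by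
    rw [SchwartzMap.fourier_coe, Real.fourier_real_eq_integral_exp_smul]
    have := Measure.integral_comp_div
      (fun x : ℝ => Complex.exp (-(Complex.I * (δ * x : ℝ) * τ)) * (η x : ℝ)) δ
    rw [abs_of_pos hδ, Complex.real_smul] at this
    calc _ = ∫ t : ℝ, Complex.exp (-(Complex.I * (δ * (t / δ) : ℝ) * τ)) * (η (t / δ) : ℝ) := by
          simp_rw [mul_div_cancel₀ _ hδ.ne']
      _ = _ := this
      _ = _ := by
          congr 1
          refine integral_congr_ae (ae_of_all _ fun x => ?_)
          change _ = _ * (η x : ℂ)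
          have := Complex.ofReal_ne_zero.2 Real.pi_ne_zero
          push_cast
          field_simp
  rw [hF, norm_mul, norm_mul, norm_inv]
  have e1 : ‖(2 * Real.pi : ℂ)‖ = 2 * Real.pi := by
    simp [abs_of_pos Real.pi_pos]
  rw [e1, Complex.norm_real, Real.norm_of_nonneg hδ.le]
  have hb := hA (δ * τ / (2 * Real.pi))
  set N := ‖(𝓕 φ : 𝓢(ℝ, ℂ)) (δ * τ / (2 * Real.pi))‖
  have hN : 0 ≤ N := norm_nonneg _
  have h1 : (1 + (δ * τ) ^ 2) ≤ (2 * Real.pi) ^ 2 * (1 + ‖δ * τ / (2 * Real.pi)‖) ^ 2 := by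
    rw [norm_div, Real.norm_eq_abs, Real.norm_of_nonneg (by positivity), ← mul_pow, mul_add,
      mul_div_cancel₀ _ (by positivity), ← sq_abs (δ * τ)]
    nlinarith [Real.pi_gt_three, abs_nonneg (δ * τ)]
  rw [mul_assoc]
  refine mul_le_mul_of_nonneg_left ?_ (by positivity)
  rw [mul_div_assoc', le_div_iff₀ (by positivity)]
  calc δ * N * (1 + (δ * τ) ^ 2)
      ≤ δ * N * ((2 * Real.pi) ^ 2 * (1 + ‖δ * τ / (2 * Real.pi)‖) ^ 2) := by gcongr
    _ = δ * (2 * Real.pi) ^ 2 * ((1 + ‖δ * τ / (2 * Real.pi)‖) ^ 2 * N) := by ring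
    _ ≤ δ * (2 * Real.pi) ^ 2 * A := by gcongr
    _ = _ := by ring

theorem coeff_smul (c : ℂ) (T : PeriodicDistribution) (k : ℤ) : coeff (c • T) k = c * coeff T k := by
  simp only [coeff, Submodule.coe_smul, LinearMap.smul_apply, smul_eq_mul]
  ring

theorem coeff_zero (k : ℤ) : coeff 0 k = 0 := by
  simp [coeff]

theorem norm_exp_I_mul (t τ : ℝ) : ‖Complex.exp (Complex.I * t * τ)‖ = 1 := by
  rw [show Complex.I * t * τ = ((t * τ : ℝ) : ℂ) * Complex.I by push_cast; ring,
    Complex.norm_exp_ofReal_mul_I]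

theorem norm_exp_neg_I_mul (t τ : ℝ) : ‖Complex.exp (-(Complex.I * t * τ))‖ = 1 := by
  rw [Complex.exp_neg, norm_inv, norm_exp_I_mul, inv_one]

section STFourier

variable {η : ℝ → ℝ} {δ : ℝ} {u : ℝ → PeriodicDistribution} {F : ℤ → ℝ → ℂ} {k : ℤ}

theorem integrable_cutoff_prod (hη : Continuous η) (hc : HasCompactSupport η) (hδ : 0 < δ)
    {f : ℝ → ℂ} (hf : Integrable f) :
    Integrable (fun p : ℝ × ℝ => ((η (p.1 / δ) : ℝ) : ℂ) *
      (Complex.exp (Complex.I * p.1 * p.2) * f p.2)) (volume.prod volume) := by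
  have h1 : Integrable fun t => ((η (t / δ) : ℝ) : ℂ) :=
    ((hη.integrable_of_hasCompactSupport hc).comp_div hδ.ne').ofReal
  have h2 := h1.mul_prod hf
  have hexp : Continuous fun p : ℝ × ℝ => Complex.exp (Complex.I * p.1 * p.2) := by fun_prop
  have h3 : AEStronglyMeasurable (fun p : ℝ × ℝ => Complex.exp (Complex.I * p.1 * p.2) *
      (((η (p.1 / δ) : ℝ) : ℂ) * f p.2)) (volume.prod volume) :=
    hexp.aestronglyMeasurable.mul h2.1
  refine (h2.mono h3 (ae_of_all _ fun p => ?_)).congr (ae_of_all _ fun p => ?_)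
  · rw [norm_mul, norm_exp_I_mul, one_mul]
  · ring

theorem coeff_cutoff (hu : HasSTFourier u F) (hk : k ≠ 0) (t : ℝ) :
    coeff (cutoff η δ u t) k =
      ∫ τ : ℝ, ((η (t / δ) : ℝ) : ℂ) * (Complex.exp (Complex.I * t * τ) * F k τ) := by
  rw [cutoff, coeff_smul, (hu k hk).2 t, integral_const_mul]

theorem integrable_coeff_cutoff (hη : Continuous η) (hc : HasCompactSupport η) (hδ : 0 < δ)
    (hu : HasSTFourier u F) (hk : k ≠ 0) : Integrable fun t => coeff (cutoff η δ u t) k := by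
  simp_rw [coeff_cutoff hu hk]
  exact (integrable_cutoff_prod hη hc hδ (hu k hk).1).integral_prod_left

theorem continuous_stFourier_cutoff (hη : Continuous η) (hc : HasCompactSupport η) (hδ : 0 < δ)
    (hu : HasSTFourier u F) (hk : k ≠ 0) : Continuous (stFourier (cutoff η δ u) k) := by
  have hi := integrable_coeff_cutoff hη hc hδ hu hk
  refine continuous_const.mul (continuous_of_dominated (bound := fun t => ‖coeff (cutoff η δ u t) k‖)
    (fun τ => ?_) (fun τ => ae_of_all _ fun t => ?_) hi.norm (ae_of_all _ fun t => ?_))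
  · have : Continuous fun t : ℝ => Complex.exp (-(Complex.I * t * τ)) := by fun_prop
    exact this.aestronglyMeasurable.mul hi.1
  · rw [norm_mul, norm_exp_neg_I_mul, one_mul]
  · fun_prop

/-- Insert the inversion formula and apply Fubini, which the integrability of `η(t/δ) F(k,τ')` on
the product permits. -/
theorem stFourier_cutoff (hη : Continuous η) (hc : HasCompactSupport η) (hδ : 0 < δ)
    (hu : HasSTFourier u F) (hk : k ≠ 0) (τ : ℝ) :
    stFourier (cutoff η δ u) k τ = ∫ τ' : ℝ, F k τ' * ((2 * Real.pi : ℂ)⁻¹ *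
      ∫ t : ℝ, Complex.exp (-(Complex.I * t * (τ - τ' : ℝ))) * (η (t / δ) : ℝ)) := by
  unfold stFourier
  simp_rw [coeff_cutoff hu hk, ← integral_const_mul]
  have hp := integrable_cutoff_prod hη hc hδ (hu k hk).1
  have hexp : Continuous fun p : ℝ × ℝ => (2 * Real.pi : ℂ)⁻¹ *
    Complex.exp (-(Complex.I * p.1 * τ)) := by fun_prop
  have hp' : Integrable (Function.uncurry fun (t τ' : ℝ) => (2 * Real.pi : ℂ)⁻¹ *
      (Complex.exp (-(Complex.I * t * τ)) *
      (((η (t / δ) : ℝ) : ℂ) * (Complex.exp (Complex.I * t * τ') * F k τ'))))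
      (volume.prod volume) := by
    refine (hp.bdd_mul (c := ‖(2 * Real.pi : ℂ)⁻¹‖) hexp.aestronglyMeasurable
      (ae_of_all _ fun p => ?_)).congr (ae_of_all _ fun p => ?_)
    · rw [norm_mul, norm_exp_neg_I_mul, mul_one]
    · simp only [Function.uncurry]; ring
  rw [integral_integral_swap hp']
  congr 1; funext τ'; congr 1; funext t
  have : Complex.exp (-(Complex.I * t * (τ - τ' : ℝ))) =
      Complex.exp (-(Complex.I * t * τ)) * Complex.exp (Complex.I * t * τ') := by
    rw [← Complex.exp_add]; congr 1; push_cast; ring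
  rw [this]; ring

theorem enorm_stFourier_cutoff_le (hη : Continuous η) (hc : HasCompactSupport η) (hδ : 0 < δ)
    {C : ℝ} (hC : 0 ≤ C) (hker : ∀ τ : ℝ,
      ‖(2 * Real.pi : ℂ)⁻¹ * ∫ t : ℝ, Complex.exp (-(Complex.I * t * τ)) * (η (t / δ) : ℝ)‖ ≤
        C * (δ / (1 + (δ * τ) ^ 2)))
    (hu : HasSTFourier u F) (hk : k ≠ 0) {f : ℝ → ENNReal} (hfm : Measurable f)
    (hf : f =ᵐ[volume] fun x => ‖F k x‖ₑ) (τ : ℝ) :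
    ‖stFourier (cutoff η δ u) k τ‖ₑ ≤ ENNReal.ofReal C * smear δ f τ := by
  rw [stFourier_cutoff hη hc hδ hu hk, smear, conv_comm, conv,
    ← lintegral_const_mul _ (by fun_prop)]
  refine (enorm_integral_le_lintegral_enorm _).trans (lintegral_mono_ae (hf.mono fun x hx => ?_))
  rw [enorm_mul, hx]
  have h : ‖(2 * Real.pi : ℂ)⁻¹ * ∫ t : ℝ, Complex.exp (-(Complex.I * t * (τ - x : ℝ))) *
      (η (t / δ) : ℝ)‖ₑ ≤ ENNReal.ofReal C * poissonKer δ (τ - x) := by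
    rw [poissonKer, ← ENNReal.ofReal_mul hC, ← ofReal_norm]
    exact ENNReal.ofReal_le_ofReal (hker _)
  exact (mul_le_mul_right h _).trans_eq (by ring)

end STFourier

/-! ### Absolute convergence of the product and the bilinear bound. -/

/-- The modulus of the product of the derivatives of two localized functions. -/
noncomputable def crossSum (δ : ℝ) (f₁ f₂ : ℤ → ℝ → ENNReal) (k : ℤ) (x : ℝ) : ENNReal :=
  ∑' k₁ : ℤ, ENNReal.ofReal (|(k₁ : ℝ)| * |((k - k₁ : ℤ) : ℝ)|) *
    conv (smear δ (f₁ k₁)) (smear δ (f₂ (k - k₁))) x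

theorem tsum_symb_mul (s δ : ℝ) (f₁ f₂ : ℤ → ℝ → ENNReal) (k : ℤ) (x : ℝ) :
    ∑' k₁ : ℤ, ENNReal.ofReal (symb s k k₁ (k - k₁)) *
        conv (smear δ (f₁ k₁)) (smear δ (f₂ (k - k₁))) x =
      ENNReal.ofReal (bracket k ^ s * (|(k : ℝ)| / (1 + (k : ℝ) ^ 2))) * crossSum δ f₁ f₂ k x := by
  have := bracket_pos k
  rw [crossSum, ← ENNReal.tsum_mul_left]
  refine tsum_congr fun k₁ => ?_
  rw [← mul_assoc, ← ENNReal.ofReal_mul (by positivity), symb]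
  congr 2
  ring

theorem measurable_crossSum {δ : ℝ} {f₁ f₂ : ℤ → ℝ → ENNReal} (hf₁ : ∀ k, Measurable (f₁ k))
    (hf₂ : ∀ k, Measurable (f₂ k)) (k : ℤ) : Measurable (crossSum δ f₁ f₂ k) :=
  Measurable.tsum fun _ =>
    (measurable_conv (measurable_smear (hf₁ _)) (measurable_smear (hf₂ _))).const_mul _

section Product

variable {G₁ G₂ : ℤ → ℝ → ℂ} {δ : ℝ} {f₁ f₂ : ℤ → ℝ → ENNReal} {R : ENNReal}

theorem lintegral_convIntegrand_le
    (h₁ : ∀ k τ, ‖G₁ k τ‖ₑ ≤ ENNReal.ofReal |(k : ℝ)| * (R * smear δ (f₁ k) τ))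
    (h₂ : ∀ k τ, ‖G₂ k τ‖ₑ ≤ ENNReal.ofReal |(k : ℝ)| * (R * smear δ (f₂ k) τ))
    (hf₁ : ∀ k, Measurable (f₁ k)) (hf₂ : ∀ k, Measurable (f₂ k)) (k : ℤ) (τ : ℝ) :
    ∫⁻ p, ‖convIntegrand G₁ G₂ k τ p‖ₑ ∂(Measure.count.prod volume) ≤
      R ^ 2 * crossSum δ f₁ f₂ k τ := by
  refine (lintegral_prod_le _).trans ?_
  rw [lintegral_count, crossSum, ← ENNReal.tsum_mul_left]
  refine ENNReal.tsum_le_tsum fun k₁ => ?_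
  have m₁ := measurable_smear (δ := δ) (hf₁ k₁)
  have m₂ := measurable_smear (δ := δ) (hf₂ (k - k₁))
  rw [conv, ← lintegral_const_mul _ (by fun_prop), ← lintegral_const_mul _ (by fun_prop)]
  refine lintegral_mono fun y => ?_
  rw [convIntegrand, enorm_mul]
  refine (mul_le_mul' (h₁ k₁ y) (h₂ (k - k₁) (τ - y))).trans_eq ?_
  rw [ENNReal.ofReal_mul (abs_nonneg _)]
  ring

theorem enorm_resolvent_mulHat_le
    (h₁ : ∀ k τ, ‖G₁ k τ‖ₑ ≤ ENNReal.ofReal |(k : ℝ)| * (R * smear δ (f₁ k) τ))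
    (h₂ : ∀ k τ, ‖G₂ k τ‖ₑ ≤ ENNReal.ofReal |(k : ℝ)| * (R * smear δ (f₂ k) τ))
    (hf₁ : ∀ k, Measurable (f₁ k)) (hf₂ : ∀ k, Measurable (f₂ k)) (s : ℝ) (k : ℤ) (τ : ℝ) :
    ENNReal.ofReal (bracket k ^ s) * ‖dxHat (resolventHat (mulHat G₁ G₂)) k τ‖ₑ ≤
      R ^ 2 * ∑' k₁ : ℤ, ENNReal.ofReal (symb s k k₁ (k - k₁)) *
        conv (smear δ (f₁ k₁)) (smear δ (f₂ (k - k₁))) τ := by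
  have hm : ‖mulHat G₁ G₂ k τ‖ₑ ≤ R ^ 2 * crossSum δ f₁ f₂ k τ :=
    (enorm_integral_le_lintegral_enorm _).trans (lintegral_convIntegrand_le h₁ h₂ hf₁ hf₂ k τ)
  have hk : ‖Complex.I * k * (1 + (k : ℂ) ^ 2)⁻¹‖ₑ = ENNReal.ofReal (|(k : ℝ)| / (1 + (k : ℝ) ^ 2)) := by
    rw [← ofReal_norm, norm_mul, norm_mul, norm_inv, Complex.norm_I, one_mul, Complex.norm_intCast,
      show (1 + (k : ℂ) ^ 2) = ((1 + (k : ℝ) ^ 2 : ℝ) : ℂ) by push_cast; rfl, Complex.norm_real,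
      Real.norm_of_nonneg (by positivity), div_eq_mul_inv]
  have := bracket_pos k
  rw [tsum_symb_mul, ENNReal.ofReal_mul (by positivity), dxHat, resolventHat, ← mul_assoc (_ * _),
    enorm_mul, hk]
  calc _ ≤ ENNReal.ofReal (bracket k ^ s) * (ENNReal.ofReal (|(k : ℝ)| / (1 + (k : ℝ) ^ 2)) *
        (R ^ 2 * crossSum δ f₁ f₂ k τ)) := by gcongr
    _ = _ := by ring

/-- The `L¹` piece of the `Z` bound is finite, so the weighted sum is finite almost everywhere, and
for `k ≠ 0` the weights are strictly positive. Any `γ` would do here. -/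
theorem ae_crossSum_lt_top {j : ℕ} (hj : 1 ≤ j) {s : ℝ} (hs : (2 - (j : ℝ)) / 2 ≤ s)
    (hδ : 0 < δ) (hδ1 : δ < 1) (hf₁ : ∀ k, Measurable (f₁ k)) (hf₂ : ∀ k, Measurable (f₂ k))
    (hn₁ : modesNorm j s f₁ ≠ ⊤) (hn₂ : modesNorm j s f₂ ≠ ⊤) {k : ℤ} (hk : k ≠ 0) :
    ∀ᵐ τ, crossSum δ f₁ f₂ k τ < ⊤ := by
  obtain ⟨C, hC, h⟩ := exists_modeZ hj hs one_pos
  have h1 := (h δ hδ hδ1 f₁ f₂ hf₁ hf₂ k hk).one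
  simp_rw [tsum_symb_mul] at h1
  have hm := measurable_crossSum (δ := δ) hf₁ hf₂ k
  have h2 := ae_lt_top' (by fun_prop) (h1.trans_lt (by finiteness)).ne
  filter_upwards [h2] with τ hτ
  have hb := bracket_pos k
  have hb' := bracket_pos (τ + disp j k)
  have hk' : 0 < |(k : ℝ)| := by positivity
  by_contra hinf
  rw [not_lt_top_iff] at hinf
  rw [hinf, ENNReal.mul_top (by simp; positivity), ENNReal.mul_top (by simp [japW]; positivity)] at hτ
  exact lt_irrefl _ hτ

end Product

/-- A measurable version of the modulus of the nonzero modes. -/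
theorem exists_measurable_modes {u : ℝ → PeriodicDistribution} {F : ℤ → ℝ → ℂ}
    (hu : HasSTFourier u F) : ∃ f : ℤ → ℝ → ENNReal, (∀ k, Measurable (f k)) ∧
      ∀ k : ℤ, k ≠ 0 → f k =ᵐ[volume] fun x => ‖F k x‖ₑ := by
  have h : ∀ k : ℤ, ∃ g : ℝ → ENNReal, Measurable g ∧
      (k ≠ 0 → g =ᵐ[volume] fun x => ‖F k x‖ₑ) := fun k => by
    by_cases hk : k = 0
    · exact ⟨0, measurable_zero, fun h => absurd hk h⟩
    · have := (hu k hk).1.1.enorm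
      exact ⟨this.mk _, this.measurable_mk, fun _ => this.ae_eq_mk.symm⟩
  choose f hf hf' using h
  exact ⟨f, hf, hf'⟩

theorem measurable_convIntegrand {G₁ G₂ : ℤ → ℝ → ℂ} (h₁ : ∀ k, Measurable (G₁ k))
    (h₂ : ∀ k, Measurable (G₂ k)) (k : ℤ) (τ : ℝ) : Measurable (convIntegrand G₁ G₂ k τ) :=
  measurable_from_prod_countable_right fun k₁ => by
    have a := h₁ k₁
    have b := h₂ (k - k₁)
    exact a.mul (b.comp (measurable_const.sub measurable_id))

theorem exists_bilinearHat_le {j : ℕ} (hj : 1 ≤ j) {s : ℝ} (hs : (2 - (j : ℝ)) / 2 ≤ s)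
    {γ : ℝ} (hγ : 0 < γ) {η : ℝ → ℝ} (hη : ContDiff ℝ ((⊤ : ℕ∞) : WithTop ℕ∞) η)
    (hc : HasCompactSupport η) :
    ∃ C : ENNReal, C ≠ ⊤ ∧ ∀ δ : ℝ, 0 < δ → δ < 1 →
      ∀ (u₁ u₂ : ℝ → PeriodicDistribution) (F₁ F₂ : ℤ → ℝ → ℂ), HasSTFourier u₁ F₁ →
        HasSTFourier u₂ F₂ → normYHat j s F₁ ≠ ⊤ → normYHat j s F₂ ≠ ⊤ →
        ProductDefined η δ u₁ u₂ ∧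
        normZHat j s (bilinearHat η δ u₁ u₂) ≤ C * ENNReal.ofReal (δ ^ (1 / 2 - γ)) *
          (normYHat j s F₁ * normYHat j s F₂) := by
  obtain ⟨C, hC, hZ⟩ := exists_normZHat_le hj hs hγ
  obtain ⟨K, hK, hker⟩ := exists_cutoff_fourier_le hη hc
  refine ⟨C * ENNReal.ofReal K ^ 2, by finiteness, ?_⟩
  intro δ hδ hδ1 u₁ u₂ F₁ F₂ hu₁ hu₂ hn₁ hn₂
  have key : ∀ (u : ℝ → PeriodicDistribution) (F : ℤ → ℝ → ℂ), HasSTFourier u F →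
      ∃ f : ℤ → ℝ → ENNReal, (∀ k, Measurable (f k)) ∧ modesNorm j s f ≤ normYHat j s F ∧
        (∀ k, Measurable (dxHat (stFourier (cutoff η δ u)) k)) ∧
        ∀ k τ, ‖dxHat (stFourier (cutoff η δ u)) k τ‖ₑ ≤
          ENNReal.ofReal |(k : ℝ)| * (ENNReal.ofReal K * smear δ (f k) τ) := by
    intro u F hu
    obtain ⟨f, hf, hfF⟩ := exists_measurable_modes hu
    refine ⟨f, hf, modesNorm_le_normYHat hf hfF, fun k => ?_, fun k τ => ?_⟩
    · by_cases hk : k = 0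
      · have : dxHat (stFourier (cutoff η δ u)) k = fun _ => 0 := by
          funext τ; simp [dxHat, hk]
        rw [this]; exact measurable_const
      · exact (continuous_stFourier_cutoff hη.continuous hc hδ hu hk).measurable.const_mul _
    · by_cases hk : k = 0
      · simp [dxHat, hk]
      · have hk' : ‖Complex.I * (k : ℂ)‖ₑ = ENNReal.ofReal |(k : ℝ)| := by
          rw [← ofReal_norm, norm_mul, Complex.norm_I, one_mul, Complex.norm_intCast]
        rw [dxHat, enorm_mul, hk']
        gcongr
        exact enorm_stFourier_cutoff_le hη.continuous hc hδ hK (hker δ hδ) hu hk (hf k) (hfF k hk) τ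
  obtain ⟨f₁, hf₁, hle₁, hm₁, hb₁⟩ := key u₁ F₁ hu₁
  obtain ⟨f₂, hf₂, hle₂, hm₂, hb₂⟩ := key u₂ F₂ hu₂
  constructor
  · intro k hk
    filter_upwards [ae_crossSum_lt_top hj hs hδ hδ1 hf₁ hf₂ (ne_top_of_le_ne_top hn₁ hle₁)
      (ne_top_of_le_ne_top hn₂ hle₂) hk] with τ hτ
    refine ⟨(measurable_convIntegrand hm₁ hm₂ k τ).aestronglyMeasurable, ?_⟩
    exact (lintegral_convIntegrand_le hb₁ hb₂ hf₁ hf₂ k τ).trans_lt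
      (ENNReal.mul_lt_top (by finiteness) hτ)
  · refine (hZ δ hδ hδ1 f₁ f₂ hf₁ hf₂ _ _ fun k _ x =>
      enorm_resolvent_mulHat_le hb₁ hb₂ hf₁ hf₂ s k x).trans ?_
    gcongr

/-! ### Passage to the infima over transforms and extensions. -/

theorem le_mul_normY {j : ℕ} {s : ℝ} {u : ℝ → PeriodicDistribution} (hu : normY j s u < ⊤)
    {x d : ENNReal} (hd : d ≠ ⊤)
    (h : ∀ F, HasSTFourier u F → normYHat j s F ≠ ⊤ → x ≤ d * normYHat j s F) :
    x ≤ d * normY j s u := by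
  rcases eq_or_ne d 0 with rfl | hd0
  · obtain ⟨F, hF⟩ := iInf_lt_iff.1 hu
    obtain ⟨hF, hlt⟩ := iInf_lt_iff.1 hF
    simpa using h F hF hlt.ne
  · rw [mul_comm, ← ENNReal.div_le_iff hd0 hd]
    refine le_iInf₂ fun F hF => ?_
    rcases eq_or_ne (normYHat j s F) ⊤ with htop | htop
    · rw [htop]; exact le_top
    · rw [ENNReal.div_le_iff hd0 hd, mul_comm]
      exact h F hF htop

theorem exists_normYHat_ne_top {j : ℕ} {s : ℝ} {u : ℝ → PeriodicDistribution}
    (hu : normY j s u < ⊤) : ∃ F, HasSTFourier u F ∧ normYHat j s F ≠ ⊤ := by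
  obtain ⟨F, hF⟩ := iInf_lt_iff.1 hu
  obtain ⟨hF, hlt⟩ := iInf_lt_iff.1 hF
  exact ⟨F, hF, hlt.ne⟩

/-- The `L²(k) L¹(τ)` piece controls each coefficient uniformly in time. -/
theorem enorm_coeff_le {j : ℕ} {s : ℝ} {u : ℝ → PeriodicDistribution} {F : ℤ → ℝ → ℂ}
    (hu : HasSTFourier u F) {k : ℤ} (hk : k ≠ 0) (t : ℝ) :
    ENNReal.ofReal (bracket k ^ s) * ‖coeff (u t) k‖ₑ ≤ normYHat j s F := by
  have h1 : ‖coeff (u t) k‖ₑ ≤ ∫⁻ τ, ‖F k τ‖ₑ := by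
    rw [(hu k hk).2 t]
    refine (enorm_integral_le_lintegral_enorm _).trans (lintegral_mono fun τ => ?_)
    rw [enorm_mul, ← ofReal_norm, norm_exp_I_mul, ENNReal.ofReal_one, one_mul]
  have h2 : ENNReal.ofReal (bracket k ^ s) * ∫⁻ τ, ‖F k τ‖ₑ ≤ weightedL2L1 j s 0 F := by
    have := ENNReal.le_tsum (f := fun k : {k : ℤ // k ≠ 0} => (∫⁻ τ : ℝ,
      ENNReal.ofReal (bracket (k.1 : ℝ) ^ s * bracket (τ + (k.1 : ℝ) ^ (2 * j + 1)) ^ (0 : ℝ))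
        * ‖F k.1 τ‖ₑ) ^ 2) ⟨k, hk⟩
    refine le_trans (le_of_eq ?_) (ENNReal.rpow_le_rpow this (by norm_num : (0 : ℝ) ≤ 1 / 2))
    rw [sqrt_sq_ennreal]
    simp only [Real.rpow_zero, mul_one]
    rw [lintegral_const_mul' _ _ ENNReal.ofReal_ne_top]
  exact (mul_le_mul_right h1 _).trans (h2.trans le_add_self)

theorem coeff_eq_zero_of_normYδ_eq_zero {j : ℕ} {s δ : ℝ} {u : ℝ → PeriodicDistribution}
    (h : normYδ j s δ u = 0) {k : ℤ} (hk : k ≠ 0) {t : ℝ} (ht : t ∈ Set.Icc 0 δ) :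
    coeff (u t) k = 0 := by
  have h1 : ENNReal.ofReal (bracket k ^ s) * ‖coeff (u t) k‖ₑ ≤ normYδ j s δ u :=
    le_iInf₂ fun v hv => le_iInf₂ fun F hF => by
      rw [← hv.2 t ht]
      exact enorm_coeff_le hF hk t
  have hb := bracket_pos k
  rw [h, nonpos_iff_eq_zero, mul_eq_zero, ENNReal.ofReal_eq_zero] at h1
  rcases h1 with h1 | h1
  · exact absurd h1 (not_le.2 (by positivity))
  · simpa using h1

theorem normY_eq_zero_of_coeff {j : ℕ} {s : ℝ} {u : ℝ → PeriodicDistribution}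
    (h : ∀ t, ∀ k : ℤ, k ≠ 0 → coeff (u t) k = 0) : normY j s u = 0 := by
  have h0 : HasSTFourier u 0 := fun k hk =>
    ⟨integrable_zero _ _ _, fun t => by simp [h t k hk]⟩
  refine nonpos_iff_eq_zero.1 ((iInf₂_le 0 h0).trans_eq ?_)
  simp [normYHat, weightedL2L2, weightedL2L1]

theorem exists_extension_normY_le {j : ℕ} {s δ : ℝ} {u : ℝ → PeriodicDistribution}
    (hz : ZeroMeanOn (Set.Icc 0 δ) u) (h : normYδ j s δ u < ⊤) :
    ∃ v, IsExtension δ u v ∧ normY j s v < ⊤ ∧ normY j s v ≤ 2 * normYδ j s δ u := by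
  classical
  -- The infimum need not be attained, and the factor `2` leaves room only when it is positive. When
  -- it is zero, all coefficients vanish on `[0,δ]`, and extension by zero has norm exactly zero.
  rcases eq_or_ne (normYδ j s δ u) 0 with h0 | h0
  · have hv : normY j s (fun t => if t ∈ Set.Icc 0 δ then u t else 0) = 0 :=
      normY_eq_zero_of_coeff fun t k hk => by
        split_ifs with ht
        · exact coeff_eq_zero_of_normYδ_eq_zero h0 hk ht
        · exact coeff_zero k
    refine ⟨fun t => if t ∈ Set.Icc 0 δ then u t else 0, ⟨fun t _ => ?_, fun t ht => if_pos ht⟩, ?_, ?_⟩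
    · beta_reduce
      split_ifs with ht
      · exact hz t ht
      · exact coeff_zero 0
    · rw [hv]; exact ENNReal.zero_lt_top
    · rw [hv]; exact zero_le
  · have hlt : normYδ j s δ u < 2 * normYδ j s δ u := by
      rw [two_mul]; exact ENNReal.lt_add_right h.ne h0
    obtain ⟨v, hv⟩ := iInf_lt_iff.1 hlt
    obtain ⟨hv, hlt⟩ := iInf_lt_iff.1 hv
    exact ⟨v, hv, hlt.trans (ENNReal.mul_lt_top (by norm_num) h), hlt.le⟩

end Shallow

theorem lemma3p7 (j : ℕ) (hj : 1 ≤ j) (s : ℝ) (hs : (2 - (j : ℝ)) / 2 ≤ s)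
    (η : ℝ → ℝ) (hη : ContDiff ℝ ((⊤ : ℕ∞) : WithTop ℕ∞) η)
    (hη_supp : Function.support η ⊆ Set.Icc (-1) 2)
    (hη_one : ∀ t ∈ Set.Icc (0 : ℝ) 1, η t = 1)
    (ε : ℝ) (hε : 0 < ε) (hε' : ε < 1 / (10000 * (2 * (j : ℝ) + 1))) :
    ∃ C : ℝ, 0 < C ∧ ∀ δ : ℝ, 0 < δ → δ < 1 →
      (∀ u₁ u₂ : ℝ → Shallow.PeriodicDistribution,
        Shallow.ZeroMeanOn Set.univ u₁ → Shallow.ZeroMeanOn Set.univ u₂ →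
        Shallow.normY j s u₁ < ⊤ → Shallow.normY j s u₂ < ⊤ →
        Shallow.ProductDefined η δ u₁ u₂ ∧
        Shallow.normZHat j s (Shallow.bilinearHat η δ u₁ u₂) ≤
          ENNReal.ofReal (C * δ ^ ((j : ℝ) / (2 * (j : ℝ) + 1) - 2 * ε)) *
            (Shallow.normY j s u₁ * Shallow.normY j s u₂)) ∧
      (∀ u₁ u₂ : ℝ → Shallow.PeriodicDistribution,
        Shallow.ZeroMeanOn (Set.Icc 0 δ) u₁ → Shallow.ZeroMeanOn (Set.Icc 0 δ) u₂ →
        Shallow.normYδ j s δ u₁ < ⊤ → Shallow.normYδ j s δ u₂ < ⊤ →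
        ∃ v₁ v₂ : ℝ → Shallow.PeriodicDistribution,
          Shallow.IsExtension δ u₁ v₁ ∧ Shallow.IsExtension δ u₂ v₂ ∧
          Shallow.normY j s v₁ < ⊤ ∧ Shallow.normY j s v₂ < ⊤ ∧
          Shallow.ProductDefined η δ v₁ v₂ ∧
          Shallow.normZHat j s (Shallow.bilinearHat η δ v₁ v₂) ≤
            ENNReal.ofReal (C * δ ^ ((j : ℝ) / (2 * (j : ℝ) + 1) - 2 * ε)) *
              (Shallow.normYδ j s δ u₁ * Shallow.normYδ j s δ u₂)) := by
  have hc : HasCompactSupport η :=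
    HasCompactSupport.of_support_subset_isCompact isCompact_Icc hη_supp
  -- This `γ` makes `1/2 - γ = j/(2j+1)`; lowering the exponent by `2ε` only weakens the bound,
  -- since `δ < 1`.
  have hγ : (0 : ℝ) < 1 / (2 * (2 * (j : ℝ) + 1)) := by positivity
  obtain ⟨C, hC, h⟩ := Shallow.exists_bilinearHat_le hj hs hγ hη hc
  have part1 : ∀ δ : ℝ, 0 < δ → δ < 1 → ∀ u₁ u₂ : ℝ → Shallow.PeriodicDistribution,
      Shallow.normY j s u₁ < ⊤ → Shallow.normY j s u₂ < ⊤ →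
      Shallow.ProductDefined η δ u₁ u₂ ∧
      Shallow.normZHat j s (Shallow.bilinearHat η δ u₁ u₂) ≤
        C * ENNReal.ofReal (δ ^ ((j : ℝ) / (2 * (j : ℝ) + 1) - 2 * ε)) *
          (Shallow.normY j s u₁ * Shallow.normY j s u₂) := by
    intro δ hδ hδ1 u₁ u₂ hn₁ hn₂
    obtain ⟨F₁, hF₁, hF₁'⟩ := Shallow.exists_normYHat_ne_top hn₁
    obtain ⟨F₂, hF₂, hF₂'⟩ := Shallow.exists_normYHat_ne_top hn₂
    refine ⟨(h δ hδ hδ1 u₁ u₂ F₁ F₂ hF₁ hF₂ hF₁' hF₂').1, ?_⟩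
    have hexp : ENNReal.ofReal (δ ^ ((1 : ℝ) / 2 - 1 / (2 * (2 * (j : ℝ) + 1)))) ≤
        ENNReal.ofReal (δ ^ ((j : ℝ) / (2 * (j : ℝ) + 1) - 2 * ε)) := by
      refine Shallow.ofReal_rpow_le hδ hδ1 ?_
      have : (1 : ℝ) / 2 - 1 / (2 * (2 * (j : ℝ) + 1)) = (j : ℝ) / (2 * (j : ℝ) + 1) := by
        field_simp; ring
      linarith
    rw [← mul_assoc]
    -- The infimum is taken in one factor at a time, the other being part of the finite constant.
    refine Shallow.le_mul_normY hn₂ (by finiteness) fun G₂ hG₂ hG₂' => ?_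
    rw [mul_right_comm]
    refine Shallow.le_mul_normY hn₁ (by finiteness) fun G₁ hG₁ hG₁' => ?_
    refine (h δ hδ hδ1 u₁ u₂ G₁ G₂ hG₁ hG₂ hG₁' hG₂').2.trans ?_
    rw [mul_assoc _ (Shallow.normYHat j s G₂), mul_comm (Shallow.normYHat j s G₂)]
    gcongr
  -- The `4` absorbs a factor `2` from each extension; the added `1` keeps the real constant
  -- positive.
  have hconst : ∀ (δ : ℝ), 0 < δ → 4 * (C * ENNReal.ofReal (δ ^ ((j : ℝ) / (2 * (j : ℝ) + 1) - 2 * ε)))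
      ≤ ENNReal.ofReal ((4 * C.toReal + 1) * δ ^ ((j : ℝ) / (2 * (j : ℝ) + 1) - 2 * ε)) := by
    intro δ hδ
    rw [ENNReal.ofReal_mul (by positivity), ← mul_assoc]
    gcongr
    rw [ENNReal.ofReal_add (by positivity) (by norm_num), ENNReal.ofReal_mul (by norm_num),
      ENNReal.ofReal_toReal hC, show ENNReal.ofReal 4 = 4 by simp]
    exact le_self_add
  refine ⟨4 * C.toReal + 1, by positivity, fun δ hδ hδ1 => ⟨?_, ?_⟩⟩
  · intro u₁ u₂ _ _ hn₁ hn₂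
    obtain ⟨hp, hb⟩ := part1 δ hδ hδ1 u₁ u₂ hn₁ hn₂
    refine ⟨hp, hb.trans (mul_le_mul_left ((le_mul_of_one_le_left' (by norm_num)).trans
      (hconst δ hδ)) _)⟩
  · intro u₁ u₂ hz₁ hz₂ hn₁ hn₂
    obtain ⟨v₁, hv₁, ht₁, hle₁⟩ := Shallow.exists_extension_normY_le hz₁ hn₁
    obtain ⟨v₂, hv₂, ht₂, hle₂⟩ := Shallow.exists_extension_normY_le hz₂ hn₂
    obtain ⟨hp, hb⟩ := part1 δ hδ hδ1 v₁ v₂ ht₁ ht₂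
    refine ⟨v₁, v₂, hv₁, hv₂, ht₁, ht₂, hp, hb.trans ?_⟩
    refine le_trans ?_ (mul_le_mul_left (hconst δ hδ) _)
    refine (mul_le_mul_right (mul_le_mul' hle₁ hle₂) _).trans_eq ?_
    ring
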